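/- **Lemma 3.2 (improved bilinear Strichartz estimate).** Let $b\in\mathbb R$, $b\ne 0$. Write $\langle y\rangle=1+|y|$ and $\widehat u(\xi,\tau)=\int_{\mathbb R^2}e^{-i(x\xi+t\tau)}u(x,t)\,dx\,dt$. For $s,\beta\ge 0$ let $X_{s,\beta}$ be the completion of the Schwartz space $\mathcal S(\mathbb R^2)$ (a subspace of $L^2(\mathbb R^2)$) with respect to $$\|u\|_{X_{s,\beta}}=\big\|\langle\tau-b\xi^3\rangle^{\beta}\langle\xi\rangle^{s}\,\widehat u(\xi,\tau)\big\|_{L^2_{\xi,\tau}},$$ and for $\rho>0$ let $$\|u\|_{X^\rho_{s,\beta}}=\inf\{\|U\|_{X_{s,\beta}}:\ U\in X_{s,\beta},\ U(x,t)=u(x,t)\text{ for a.e. }x\in\mathbb R,\ t\in[0,\rho]\}.$$ Let $\|f\|_{L^4_xL^2_\rho}=\big(\int_{\mathbb R}(\int_0^\rho|f(x,t)|^2dt)^{2}dx\big)^{1/4}$, and let $\|f\|_{L^4_xL^2_t}$ be the same norm with $t$ ranging over $\mathbb R$. Let $\beta>1/2$ and $0<\kappa<c_1\le c_2$. There is a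 constant $C>0$, depending only on $b,\beta,\kappa,c_1,c_2$, such that for all $s>1/4$, all $N>0$ and all $v_1,v_2\in\mathcal S(\mathbb R\times\mathbb R)$ with $$\operatorname{supp}\widehat{v_1}\subset\{(\xi,\tau):c_1N\le|\xi|\le c_2N\},\qquad \operatorname{supp}\widehat{v_2}\subset\{(\xi,\tau):|\xi|\le\kappa N\},$$ one has, for every $\rho>0$, $$\|v_1v_2\|_{L^4_xL^2_\rho}\le \frac{C}{(4s-1)^{1/4}}\,\frac1N\,\|v_2\|_{X^\rho_{s,\beta}}\,\|v_1\|_{X^\rho_{0,\beta}},$$ and also $$\|v_1v_2\|_{L^4_xL^2_t}\le \frac{C}{(4s-1)^{1/4}}\,\frac1N\,\|v_2\|_{X_{s,\beta}}\,\|v_1\|_{X_{0,\beta}}.$$ -/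

import Mathlib

open MeasureTheory Set Real
open scoped ENNReal SchwartzMap FourierTransform

noncomputable section

namespace Airy

/-- Both the space-time plane, with points `p = (x, t)` (`x = p 0`, `t = p 1`), and the frequency
plane, with points `ζ = (ξ, τ)` (`ξ = ζ 0`, `τ = ζ 1`). -/
abbrev Plane : Type := EuclideanSpace ℝ (Fin 2)

/-- Complex-valued square-integrable functions on the plane. -/
abbrev L2Plane : Type := Lp ℂ 2 (volume : Measure Plane)

/-- The bracket `⟨y⟩ = 1 + |y|`. -/
def bracket (y : ℝ) : ℝ := 1 + |y|

/-- The space-time Fourier transform `∫ e^{-i(xξ+tτ)} v(x,t) dx dt` of a Schwartz function. -/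
def hat (v : 𝓢(Plane, ℂ)) (ζ : Plane) : ℂ :=
  ∫ p : Plane, Complex.exp (-Complex.I * ((p 0 * ζ 0 + p 1 * ζ 1 : ℝ) : ℂ)) * v p

/-- The Fourier transform, with kernel `e^{-i(xξ+tτ)}`, of a function in `L²(ℝ²)`. Mathlib's
transform is normalized with the kernel `e^{-2πi(xξ+tτ)}`, so the frequency is divided by `2π`. -/
def hatL2 (U : L2Plane) (ζ : Plane) : ℂ :=
  (𝓕 U : L2Plane) ((2 * π)⁻¹ • ζ)

/-- The norm `‖⟨τ - bξ³⟩^β ⟨ξ⟩^s û(ξ,τ)‖_{L²}` of the Bourgain space `X_{s,β}` of the group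
`e^{-tb∂ₓ³}`, with the value `∞` when `U` is not in `X_{s,β}`. For `s, β ≥ 0` (the only case used)
the weight is at least `1`, so that `X_{s,β}`, the completion of the Schwartz space in this norm,
is exactly the set of `U ∈ L²(ℝ²)` at which it is finite. -/
def xNorm (b s β : ℝ) (U : L2Plane) : ℝ≥0∞ :=
  eLpNorm (fun ζ : Plane =>
    ((bracket (ζ 1 - b * ζ 0 ^ 3) ^ β * bracket (ζ 0) ^ s : ℝ) : ℂ) * hatL2 U ζ) 2 volume

/-- The norm of the restriction space `X^ρ_{s,β}`: the infimum of `‖U‖_{X_{s,β}}` over all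
`U` that agree with `u` for `t ∈ [0, ρ]` (extensions outside `X_{s,β}` contribute `∞`). -/
def xNormOn (ρ b s β : ℝ) (u : Plane → ℂ) : ℝ≥0∞ :=
  ⨅ (U : L2Plane) (_ : ∀ᵐ p : Plane, p 1 ∈ Icc 0 ρ → U p = u p), xNorm b s β U

/-- The mixed norm `‖f‖_{L⁴ₓL²_t}`, where `t` ranges over the set `T`. -/
def mixedNorm (T : Set ℝ) (f : Plane → ℂ) : ℝ≥0∞ :=
  eLpNorm (fun x : ℝ => eLpNorm (fun t : ℝ => f !₂[x, t]) 2 (volume.restrict T)) 4 volume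

end Airy

end

/-!
Write `u_j = 𝓕⁻ g_j`. The estimate combines three facts about the weights `⟨τ - bξ³⟩^{-2β}`, each of
which is a change of variables along the phase `bξ³` or along the resonance function
`b(ξ - ξ')³ + bξ'³`:

* local smoothing: on `|ξ| ≥ c₁N` the phase has derivative of size `N²`, so that `u₁` is in `L²_t`
  on every line `x = const`, with norm `O(N⁻¹)`
  (`lintegral_stripWeight_sq_horizontal_le`, `lintegral_fourierInv_vertical_le`);
* bilinear smoothing: since `κ < c₁`, the resonance function has derivative of size `N²`, so that
  multiplication by `u₁` maps low-frequency functions of `X_{0,β}` to `L²` with norm `O(N⁻¹)`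
  (`lintegral_stripWeight_convolution_le`, and in dual form `lintegral_weight_mul_correlation_le`);
* summability: `∫ ⟨ξ⟩^{-4s} dξ = 2/(4s-1)` (`lintegral_stripWeight_sq_mul_decay_le`).

The first and third would give an `L^∞ₓL²_t` bound at regularity `2s > 1/2`, the second gives an
`L²ₓL²_t` bound at regularity `0`, and the claim is the midpoint of the two. Instead of complex
interpolation the midpoint is obtained by a Hilbert–Schmidt bound. By duality it suffices to bound
`∫ w(x) |u₁ u₂|² dx dt` by the `L²` norm of `w`. Expanding `|u₂|²` in frequency turns it into a
quadratic form in `g₂`, whose kernel `K(ζ' - ζ)` is the Fourier transform of `w |u₁|²`. The weighted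
`L²` norm of this kernel in `ζ'`, for fixed `ζ`, is controlled by the dual bilinear estimate applied
to `w u₁`, and `‖w u₁‖_{L²}` by local smoothing; the integral in `ζ` is then the third fact
(`sq_lintegral_kernel_le`, `sq_lintegral_weight_mul_fourierInv_le`). Taking for `w` truncations of
`∫ |u₁ u₂|² dt` gives the mixed norm (`mixedNorm_fourierInv_mul_pow_four_le`).

For the restriction norms one needs to know that an extension `U` of `v|_{[0,ρ]}` can be localized
in the frequency `ξ` without changing it on `[0,ρ]`: a multiplier in `ξ` alone commutes with
restriction in time, and it fixes `v` (`fourierInv_stripPart_eq`). Its localized part then has an integrable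
Fourier transform, so that the estimate applies to it directly.
-/

namespace Airy

/-! ### The Fourier transform on `L¹ ∩ L²` -/

section Fourier

variable {V : Type*} [NormedAddCommGroup V] [InnerProductSpace ℝ V] [FiniteDimensional ℝ V]
  [MeasurableSpace V] [BorelSpace V]

theorem continuous_fourier {f : V → ℂ} (hf : Integrable f) : Continuous (𝓕 f) :=
  VectorFourier.fourierIntegral_continuous Real.continuous_fourierChar
    (by exact continuous_inner) hf

theorem continuous_fourierInv {f : V → ℂ} (hf : Integrable f) : Continuous (𝓕⁻ f) := by
  rw [fourierInv_eq_fourier_comp_neg]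
  exact continuous_fourier hf.comp_neg

theorem norm_fourierInv_le {f : V → ℂ} (x : V) : ‖𝓕⁻ f x‖ ≤ ∫ v, ‖f v‖ := by
  rw [Real.fourierInv_eq]
  refine (norm_integral_le_integral_norm _).trans_eq ?_
  simp

theorem integral_fourier_mul {f g : V → ℂ} (hf : Integrable f) (hg : Integrable g) :
    ∫ x, 𝓕 f x * g x = ∫ x, f x * 𝓕 g x := by
  have := VectorFourier.integral_fourierIntegral_smul_eq_flip (μ := (volume : Measure V))
    (ν := (volume : Measure V)) (L := innerₗ V)
    Real.continuous_fourierChar (by exact continuous_inner) hf hg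
  rw [flip_innerₗ] at this
  exact this

theorem integral_fourierInv_mul {f g : V → ℂ} (hf : Integrable f) (hg : Integrable g) :
    ∫ x, 𝓕⁻ f x * g x = ∫ x, f x * 𝓕⁻ g x := by
  rw [fourierInv_eq_fourier_comp_neg, integral_fourier_mul hf.comp_neg hg,
    ← integral_neg_eq_self]
  simp [fourierInv_eq_fourier_neg]

/-- The `L²` inverse Fourier transform of a function in `L¹ ∩ L²` is given by the Fourier integral:
both have the same pairing with every test function. -/
theorem coeFn_fourierInv_toLp {f : V → ℂ} (hf : Integrable f) (hf2 : MemLp f 2) :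
    ((𝓕⁻ (hf2.toLp f) : Lp ℂ 2 (volume : Measure V)) : V → ℂ) =ᵐ[volume] 𝓕⁻ f := by
  refine ae_eq_of_integral_contDiff_smul_eq
    ((Lp.memLp _).locallyIntegrable one_le_two) (continuous_fourierInv hf).locallyIntegrable ?_
  intro g g_smooth g_cpt
  have hg₁ : HasCompactSupport (Complex.ofRealCLM ∘ g) := g_cpt.comp_left rfl
  have hg₂ : ContDiff ℝ ((⊤ : ℕ∞) : WithTop ℕ∞) (Complex.ofRealCLM ∘ g) :=
    Complex.ofRealCLM.contDiff.comp g_smooth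
  set φ : 𝓢(V, ℂ) := hg₁.toSchwartzMap hg₂
  have hφ : ∀ x, φ x = g x := fun x => rfl
  have h1 := congrArg (fun T : 𝓢'(V, ℂ) => T φ)
    (Lp.fourierInv_toTemperedDistribution_eq (hf2.toLp f))
  simp only [TemperedDistribution.fourierInv_apply, Lp.toTemperedDistribution_apply] at h1
  calc ∫ x, g x • (𝓕⁻ (hf2.toLp f) : Lp ℂ 2 (volume : Measure V)) x
      = ∫ x, φ x • (𝓕⁻ (hf2.toLp f) : Lp ℂ 2 (volume : Measure V)) x := by
        simp [hφ]
    _ = ∫ x, (𝓕⁻ φ) x • (hf2.toLp f) x := h1.symm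
    _ = ∫ x, 𝓕⁻ (φ : V → ℂ) x * f x := by
        refine integral_congr_ae ?_
        filter_upwards [hf2.coeFn_toLp] with x hx
        rw [hx, SchwartzMap.fourierInv_coe, smul_eq_mul]
    _ = ∫ x, φ x * 𝓕⁻ f x := integral_fourierInv_mul φ.integrable hf
    _ = _ := by simp [hφ]

theorem eLpNorm_natCast_pow {α ε : Type*} [MeasurableSpace α] {μ : Measure α} [ENorm ε]
    (f : α → ε) {n : ℕ} (hn : n ≠ 0) : eLpNorm f n μ ^ n = ∫⁻ x, ‖f x‖ₑ ^ n ∂μ := by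
  rw [eLpNorm_eq_lintegral_rpow_enorm_toReal (by exact_mod_cast hn) (ENNReal.natCast_ne_top n),
    ← ENNReal.rpow_natCast, ← ENNReal.rpow_mul]
  have : (n : ℝ) ≠ 0 := by exact_mod_cast hn
  simp [this]

theorem eLpNorm_two_sq {α ε : Type*} [MeasurableSpace α] {μ : Measure α} [ENorm ε]
    (f : α → ε) : eLpNorm f 2 μ ^ 2 = ∫⁻ x, ‖f x‖ₑ ^ 2 ∂μ := by
  exact_mod_cast eLpNorm_natCast_pow f two_ne_zero

/-- Plancherel's identity for the Fourier integral of a function in `L¹ ∩ L²`. -/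
theorem lintegral_fourierInv_sq {f : V → ℂ} (hf : Integrable f) (hf2 : MemLp f 2) :
    ∫⁻ x, ‖𝓕⁻ f x‖ₑ ^ 2 = ∫⁻ x, ‖f x‖ₑ ^ 2 := by
  have h1 := Lp.norm_fourier_eq (𝓕⁻ (hf2.toLp f) : Lp ℂ 2 (volume : Measure V))
  rw [FourierTransform.fourier_fourierInv_eq, Lp.norm_def, Lp.norm_def,
    ENNReal.toReal_eq_toReal_iff' (Lp.eLpNorm_ne_top _)
    (Lp.eLpNorm_ne_top _), eLpNorm_congr_ae (coeFn_fourierInv_toLp hf hf2),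
    eLpNorm_congr_ae hf2.coeFn_toLp] at h1
  rw [← eLpNorm_two_sq, ← eLpNorm_two_sq, h1]

theorem lintegral_fourier_sq {f : V → ℂ} (hf : Integrable f) (hf2 : MemLp f 2) :
    ∫⁻ x, ‖𝓕 f x‖ₑ ^ 2 = ∫⁻ x, ‖f x‖ₑ ^ 2 := by
  rw [← lintegral_fourierInv_sq hf hf2, ← lintegral_neg_eq_self]
  simp only [fourierInv_eq_fourier_neg]

/-- The multiplication formula, for one function in `L²` and one in `L¹ ∩ L²`. -/
theorem integral_fourier_mul_of_memLp (U : Lp ℂ 2 (volume : Measure V)) {ψ : V → ℂ}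
    (hψ : Integrable ψ) (hψ2 : MemLp ψ 2) :
    ∫ x, (𝓕 U : Lp ℂ 2 (volume : Measure V)) x * ψ x = ∫ x, U x * 𝓕 ψ x := by
  have hc : Integrable fun x => starRingEnd ℂ (ψ x) :=
    Complex.conjLIE.toContinuousLinearEquiv.integrable_comp_iff.2 hψ
  have hc2 : MemLp (fun x => starRingEnd ℂ (ψ x)) 2 := hψ2.star
  have hconj : ∀ x, starRingEnd ℂ (𝓕⁻ (fun x => starRingEnd ℂ (ψ x)) x) = 𝓕 ψ x := by
    intro x
    rw [Real.fourierInv_eq, Real.fourier_eq, ← integral_conj]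
    congr 1; ext v
    rw [Circle.smul_def, Circle.smul_def, smul_eq_mul, smul_eq_mul, map_mul,
      AddChar.map_neg_eq_inv, Circle.coe_inv_eq_conj, Complex.conj_conj]
  have h := Lp.inner_fourier_eq (𝓕⁻ (hc2.toLp _) : Lp ℂ 2 (volume : Measure V)) U
  rw [FourierTransform.fourier_fourierInv_eq, L2.inner_def, L2.inner_def] at h
  calc ∫ x, (𝓕 U : Lp ℂ 2 (volume : Measure V)) x * ψ x
      = ∫ x, inner ℂ ((hc2.toLp _ : Lp ℂ 2 (volume : Measure V)) x)
          ((𝓕 U : Lp ℂ 2 (volume : Measure V)) x) := by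
        refine integral_congr_ae ?_
        filter_upwards [hc2.coeFn_toLp] with x hx
        rw [hx, RCLike.inner_apply, Complex.conj_conj]
    _ = _ := h
    _ = ∫ x, U x * 𝓕 ψ x := by
        refine integral_congr_ae ?_
        filter_upwards [coeFn_fourierInv_toLp hc hc2] with x hx
        rw [hx, RCLike.inner_apply, hconj]

end Fourier

/-! ### Integration over the plane -/

/-- The coordinates `p ↦ (p 0, p 1)` of the plane. -/
def planeEquiv : Plane ≃ᵐ ℝ × ℝ :=
  (MeasurableEquiv.toLp 2 (Fin 2 → ℝ)).symm.trans MeasurableEquiv.finTwoArrow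

theorem measurePreserving_planeEquiv_symm : MeasurePreserving planeEquiv.symm :=
  MeasurePreserving.symm _ ((volume_preserving_finTwoArrow ℝ).comp
    (EuclideanSpace.volume_preserving_symm_measurableEquiv_toLp (Fin 2)))

theorem measurable_mk : Measurable fun q : ℝ × ℝ => (!₂[q.1, q.2] : Plane) :=
  planeEquiv.symm.measurable

theorem continuous_mk_right (x : ℝ) : Continuous fun t : ℝ => (!₂[x, t] : Plane) := by
  fun_prop

theorem measurable_mk_right (x : ℝ) : Measurable fun t : ℝ => (!₂[x, t] : Plane) :=
  measurable_mk.comp (by fun_prop : Measurable fun t : ℝ => (x, t))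

theorem measurable_mk_left (t : ℝ) : Measurable fun x : ℝ => (!₂[x, t] : Plane) :=
  measurable_mk.comp (by fun_prop : Measurable fun x : ℝ => (x, t))

theorem lintegral_plane {f : Plane → ℝ≥0∞} (hf : Measurable f) :
    ∫⁻ p, f p = ∫⁻ x : ℝ, ∫⁻ t : ℝ, f !₂[x, t] := by
  rw [← measurePreserving_planeEquiv_symm.lintegral_comp hf, Measure.volume_eq_prod]
  exact lintegral_prod _ (hf.comp planeEquiv.symm.measurable).aemeasurable

theorem lintegral_plane_symm {f : Plane → ℝ≥0∞} (hf : Measurable f) :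
    ∫⁻ p, f p = ∫⁻ t : ℝ, ∫⁻ x : ℝ, f !₂[x, t] := by
  rw [← measurePreserving_planeEquiv_symm.lintegral_comp hf, Measure.volume_eq_prod]
  exact lintegral_prod_symm _ (hf.comp planeEquiv.symm.measurable).aemeasurable

theorem integrable_plane_iff {f : Plane → ℂ} :
    Integrable (fun q : ℝ × ℝ => f !₂[q.1, q.2]) (volume.prod volume) ↔ Integrable f := by
  rw [← Measure.volume_eq_prod]
  exact measurePreserving_planeEquiv_symm.integrable_comp_emb planeEquiv.symm.measurableEmbedding

theorem integral_plane_symm {f : Plane → ℂ} (hf : Integrable f) :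
    ∫ p, f p = ∫ t : ℝ, ∫ x : ℝ, f !₂[x, t] := by
  rw [← measurePreserving_planeEquiv_symm.integral_comp planeEquiv.symm.measurableEmbedding,
    Measure.volume_eq_prod]
  exact integral_prod_symm _ (integrable_plane_iff.2 hf)

/-- The Cauchy–Schwarz inequality for the lower Lebesgue integral. -/
theorem sq_lintegral_mul_le {α : Type*} [MeasurableSpace α] {μ : Measure α} {f g : α → ℝ≥0∞}
    (hf : AEMeasurable f μ) (hg : AEMeasurable g μ) :
    (∫⁻ x, f x * g x ∂μ) ^ 2 ≤ (∫⁻ x, f x ^ 2 ∂μ) * ∫⁻ x, g x ^ 2 ∂μ := by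
  have h := ENNReal.lintegral_mul_le_Lp_mul_Lq μ Real.HolderConjugate.two_two hf hg
  have h2 := pow_le_pow_left' h 2
  simp only [Pi.mul_apply, mul_pow, ← ENNReal.rpow_natCast, ← ENNReal.rpow_mul] at h2
  simpa using h2

/-! ### Local smoothing -/

/-- The inverse Fourier transform on the plane as an iterated transform, first in `ξ`. -/
theorem fourierInv_mk {g : Plane → ℂ} (hg : Integrable g) (x t : ℝ) :
    𝓕⁻ g !₂[x, t] = 𝓕⁻ (fun τ : ℝ => ∫ ξ : ℝ, 𝐞 (ξ * x) • g !₂[ξ, τ]) t := by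
  have hint : Integrable fun v : Plane => 𝐞 (inner ℝ v !₂[x, t]) • g v := by
    have := (Real.fourierIntegral_convergent_iff (f := g) (-!₂[x, t] : Plane)).2 hg
    simpa using this
  rw [Real.fourierInv_eq, Real.fourierInv_eq, integral_plane_symm hint]
  congr 1; ext τ
  rw [Circle.smul_def, ← integral_smul]
  congr 1; ext ξ
  rw [← Circle.smul_def, smul_smul, ← AddChar.map_add_eq_mul]
  congr 3
  simp [PiLp.inner_apply, Fin.sum_univ_two]
  ring

/-- If `|g| ≤ μ a`, then the inverse Fourier transform of `g` is square integrable on every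
vertical line, uniformly, as soon as `μ²` has bounded integrals over the horizontal lines. -/
theorem lintegral_fourierInv_vertical_le {g : Plane → ℂ} {μ a : Plane → ℝ≥0∞} {A : ℝ≥0∞}
    (hg : Integrable g) (hμ : Measurable μ) (ha : Measurable a) (hga : ∀ ζ, ‖g ζ‖ₑ ≤ μ ζ * a ζ)
    (hA : ∀ τ : ℝ, ∫⁻ ξ : ℝ, μ !₂[ξ, τ] ^ 2 ≤ A) (x : ℝ) :
    ∫⁻ t : ℝ, ‖𝓕⁻ g !₂[x, t]‖ₑ ^ 2 ≤ A * ∫⁻ ζ, a ζ ^ 2 := by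
  set k : ℝ → ℂ := fun τ => ∫ ξ : ℝ, 𝐞 (ξ * x) • g !₂[ξ, τ]
  have hkint : Integrable k := by
    have h1 : Integrable fun ζ : Plane => 𝐞 (ζ 0 * x) • g ζ := by
      have := (Real.fourierIntegral_convergent_iff (f := g) (-!₂[x, 0] : Plane)).2 hg
      simpa [PiLp.inner_apply, Fin.sum_univ_two, mul_comm] using this
    exact (integrable_plane_iff.2 h1).integral_prod_right
  have hbound : ∫⁻ τ, ‖k τ‖ₑ ^ 2 ≤ A * ∫⁻ ζ, a ζ ^ 2 := by
    have hm : Measurable fun τ : ℝ => ∫⁻ ξ : ℝ, a !₂[ξ, τ] ^ 2 :=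
      ((ha.pow_const 2).comp measurable_mk).lintegral_prod_left'
    rw [lintegral_plane_symm (ha.pow_const 2), ← lintegral_const_mul _ hm]
    refine lintegral_mono fun τ => ?_
    have h1 : ‖k τ‖ₑ ≤ ∫⁻ ξ : ℝ, μ !₂[ξ, τ] * a !₂[ξ, τ] := by
      refine (enorm_integral_le_lintegral_enorm _).trans (lintegral_mono fun ξ => ?_)
      refine le_trans (le_of_eq ?_) (hga _)
      rw [← ofReal_norm, ← ofReal_norm, Circle.norm_smul]
    calc ‖k τ‖ₑ ^ 2 ≤ (∫⁻ ξ : ℝ, μ !₂[ξ, τ] * a !₂[ξ, τ]) ^ 2 := pow_le_pow_left' h1 2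
      _ ≤ (∫⁻ ξ : ℝ, μ !₂[ξ, τ] ^ 2) * ∫⁻ ξ : ℝ, a !₂[ξ, τ] ^ 2 :=
        sq_lintegral_mul_le (hμ.comp (measurable_mk_left τ)).aemeasurable
          (ha.comp (measurable_mk_left τ)).aemeasurable
      _ ≤ _ := by gcongr; exact hA τ
  rcases eq_or_ne (A * ∫⁻ ζ, a ζ ^ 2) ∞ with htop | htop
  · rw [htop]; exact le_top
  have hk2 : MemLp k 2 := by
    refine ⟨hkint.1, ?_⟩
    rw [eLpNorm_lt_top_iff_lintegral_rpow_enorm_lt_top two_ne_zero ENNReal.ofNat_ne_top]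
    simpa using hbound.trans_lt htop.lt_top
  simp_rw [fourierInv_mk hg]
  rw [lintegral_fourierInv_sq hkint hk2]
  exact hbound

/-! ### Products of functions with prescribed spectrum -/

/-- The Fourier transform of a product with `conj (𝓕⁻ g)` is a correlation with `g`. -/
theorem fourier_conj_fourierInv_mul {g φ : Plane → ℂ} (hg : Integrable g) (hφ : Integrable φ)
    (ζ : Plane) :
    𝓕 (fun p => starRingEnd ℂ (𝓕⁻ g p) * φ p) ζ =
      ∫ η, starRingEnd ℂ (g η) * 𝓕 φ (ζ + η) := by
  have hconj : ∀ p, starRingEnd ℂ (𝓕⁻ g p) = 𝓕 (fun η => starRingEnd ℂ (g η)) p := by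
    intro p
    rw [Real.fourierInv_eq, Real.fourier_eq, ← integral_conj]
    congr 1; ext v
    rw [Circle.smul_def, Circle.smul_def, smul_eq_mul, smul_eq_mul, map_mul,
      AddChar.map_neg_eq_inv, Circle.coe_inv_eq_conj]
  have hφ' : Integrable fun p => 𝐞 (-inner ℝ p ζ) • φ p :=
    (Real.fourierIntegral_convergent_iff ζ).2 hφ
  have hgc : Integrable fun η => starRingEnd ℂ (g η) :=
    Complex.conjLIE.toContinuousLinearEquiv.integrable_comp_iff.2 hg
  calc 𝓕 (fun p => starRingEnd ℂ (𝓕⁻ g p) * φ p) ζ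
      = ∫ p, 𝓕 (fun η => starRingEnd ℂ (g η)) p * (𝐞 (-inner ℝ p ζ) • φ p) := by
        rw [Real.fourier_eq]
        congr 1; ext p
        rw [hconj, mul_smul_comm]
    _ = ∫ η, starRingEnd ℂ (g η) * 𝓕 (fun p => 𝐞 (-inner ℝ p ζ) • φ p) η :=
        integral_fourier_mul hgc hφ'
    _ = _ := by
        congr 1; ext η
        congr 1
        rw [Real.fourier_eq, Real.fourier_eq]
        congr 1; ext p
        rw [smul_smul, ← AddChar.map_add_eq_mul, inner_add_right]
        congr 2
        ring

theorem enorm_fourier_conj_fourierInv_mul_le {g φ : Plane → ℂ} (hg : Integrable g)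
    (hφ : Integrable φ) (ζ : Plane) :
    ‖𝓕 (fun p => starRingEnd ℂ (𝓕⁻ g p) * φ p) ζ‖ₑ ≤ ∫⁻ η, ‖g η‖ₑ * ‖𝓕 φ (ζ + η)‖ₑ := by
  rw [fourier_conj_fourierInv_mul hg hφ]
  refine (enorm_integral_le_lintegral_enorm _).trans_eq ?_
  congr 1; ext η
  rw [enorm_mul, RCLike.enorm_conj]

theorem integrable_conj_fourierInv_mul {g φ : Plane → ℂ} (hg : Integrable g)
    (hφ : Integrable φ) : Integrable fun p => starRingEnd ℂ (𝓕⁻ g p) * φ p := by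
  refine hφ.bdd_mul (c := ∫ v, ‖g v‖)
    (Complex.continuous_conj.comp (continuous_fourierInv hg)).aestronglyMeasurable ?_
  exact Filter.Eventually.of_forall fun p => by
    rw [RCLike.norm_conj]; exact norm_fourierInv_le p

/-- Expanding `|𝓕⁻ g|²` against an integrable function `h`, in frequency space. -/
theorem enorm_integral_normSq_fourierInv_le {g h : Plane → ℂ} (hg : Integrable g)
    (hh : Integrable h) :
    ‖∫ p, 𝓕⁻ g p * (starRingEnd ℂ (𝓕⁻ g p) * h p)‖ₑ ≤
      ∫⁻ ζ, ∫⁻ η, ‖g ζ‖ₑ * ‖g η‖ₑ * ‖𝓕 h (η - ζ)‖ₑ := by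
  rw [integral_fourierInv_mul hg (integrable_conj_fourierInv_mul hg hh)]
  refine (enorm_integral_le_lintegral_enorm _).trans (lintegral_mono fun ζ => ?_)
  rw [enorm_mul, fourierInv_eq_fourier_neg]
  refine (mul_le_mul_right (enorm_fourier_conj_fourierInv_mul_le hg hh (-ζ)) _).trans ?_
  rw [← lintegral_const_mul' _ _ enorm_ne_top]
  refine lintegral_mono fun η => le_of_eq ?_
  rw [mul_assoc, neg_add_eq_sub]

/-- The Fourier transform of a real function is conjugate symmetric. -/
theorem enorm_fourier_neg {h : Plane → ℂ} (hh : ∀ p, starRingEnd ℂ (h p) = h p) (ζ : Plane) :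
    ‖𝓕 h (-ζ)‖ₑ = ‖𝓕 h ζ‖ₑ := by
  rw [← RCLike.enorm_conj (𝓕 h ζ)]
  congr 1
  rw [Real.fourier_eq, Real.fourier_eq, ← integral_conj]
  congr 1; ext v
  rw [Circle.smul_def, Circle.smul_def, smul_eq_mul, smul_eq_mul, map_mul, hh, inner_neg_right,
    neg_neg, AddChar.map_neg_eq_inv, Circle.coe_inv_eq_conj, Complex.conj_conj]

/-! ### The bilinear estimate -/

/-- The bilinear `L²` estimate in dual form: it only needs a bound for `μ₁² ∗ μ₂²`. -/
theorem lintegral_weight_mul_correlation_le {μ₁ μ₂ a f Φ : Plane → ℝ≥0∞} {B : ℝ≥0∞}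
    (hμ₁ : Measurable μ₁) (hμ₂ : Measurable μ₂) (ha : Measurable a) (hΦ : Measurable Φ)
    (hf : ∀ ζ, f ζ ≤ μ₁ ζ * a ζ)
    (hB : ∀ ζ, ∫⁻ η, μ₁ (ζ - η) ^ 2 * μ₂ η ^ 2 ≤ B) (ζ : Plane) :
    ∫⁻ η, μ₂ η ^ 2 * (∫⁻ θ, f θ * Φ (η - ζ + θ)) ^ 2 ≤
      B * (∫⁻ θ, a θ ^ 2) * ∫⁻ θ, Φ θ ^ 2 := by
  have hsub : Measurable fun q : Plane × Plane => q.1 - ζ + q.2 := by fun_prop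
  have key : ∀ η, μ₂ η ^ 2 * (∫⁻ θ, f θ * Φ (η - ζ + θ)) ^ 2 ≤
      (∫⁻ θ, a θ ^ 2) * ∫⁻ θ, μ₂ η ^ 2 * (μ₁ (θ + ζ - η) ^ 2 * Φ θ ^ 2) := by
    intro η
    have h1 : (∫⁻ θ, f θ * Φ (η - ζ + θ)) ^ 2 ≤
        (∫⁻ θ, a θ ^ 2) * ∫⁻ θ, (μ₁ θ * Φ (η - ζ + θ)) ^ 2 := by
      refine le_trans (pow_le_pow_left' (lintegral_mono fun θ => ?_) 2)
        (sq_lintegral_mul_le ha.aemeasurable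
          (hμ₁.mul (hΦ.comp (measurable_const_add _))).aemeasurable)
      rw [← mul_assoc, mul_comm (a θ)]
      gcongr
      exact hf θ
    have h2 : ∫⁻ θ, (μ₁ θ * Φ (η - ζ + θ)) ^ 2 = ∫⁻ θ, μ₁ (θ + ζ - η) ^ 2 * Φ θ ^ 2 := by
      rw [← lintegral_add_left_eq_self (fun θ => μ₁ (θ + ζ - η) ^ 2 * Φ θ ^ 2) (η - ζ)]
      congr 1; ext θ
      rw [mul_pow]
      congr 3
      abel
    calc _ ≤ μ₂ η ^ 2 * ((∫⁻ θ, a θ ^ 2) * ∫⁻ θ, μ₁ (θ + ζ - η) ^ 2 * Φ θ ^ 2) := by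
          rw [← h2]; gcongr
      _ = _ := by
          rw [lintegral_const_mul _ (by fun_prop)]
          ring
  have hmeas : Measurable fun q : Plane × Plane =>
      μ₂ q.1 ^ 2 * (μ₁ (q.2 + ζ - q.1) ^ 2 * Φ q.2 ^ 2) := by fun_prop
  calc _ ≤ ∫⁻ η, (∫⁻ θ, a θ ^ 2) * ∫⁻ θ, μ₂ η ^ 2 * (μ₁ (θ + ζ - η) ^ 2 * Φ θ ^ 2) :=
        lintegral_mono key
    _ = (∫⁻ θ, a θ ^ 2) * ∫⁻ θ, ∫⁻ η, μ₂ η ^ 2 * (μ₁ (θ + ζ - η) ^ 2 * Φ θ ^ 2) := by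
        rw [lintegral_const_mul _ hmeas.lintegral_prod_right',
          lintegral_lintegral_swap hmeas.aemeasurable]
    _ ≤ (∫⁻ θ, a θ ^ 2) * ∫⁻ θ, B * Φ θ ^ 2 := by
        gcongr with θ
        calc ∫⁻ η, μ₂ η ^ 2 * (μ₁ (θ + ζ - η) ^ 2 * Φ θ ^ 2)
            = (∫⁻ η, μ₁ (θ + ζ - η) ^ 2 * μ₂ η ^ 2) * Φ θ ^ 2 := by
              rw [← lintegral_mul_const _ (by fun_prop)]
              congr 1; ext η
              ring
          _ ≤ _ := by gcongr; exact hB _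
    _ = _ := by
        rw [lintegral_const_mul _ (hΦ.pow_const 2)]
        ring

/-- A Hilbert–Schmidt bound for an integral operator whose kernel `K (η - ζ)` is even and has
columns that are square integrable with weight `μ²`, on functions controlled by `μ ν a`. -/
theorem sq_lintegral_kernel_le {μ ν a f K : Plane → ℝ≥0∞} {D Q : ℝ≥0∞}
    (hμ : Measurable μ) (hν : Measurable ν) (ha : Measurable a) (hK : Measurable K)
    (hf : ∀ ζ, f ζ ≤ μ ζ * ν ζ * a ζ) (hKneg : ∀ ζ, K (-ζ) = K ζ)
    (hD : ∫⁻ ζ, μ ζ ^ 2 * ν ζ ^ 4 ≤ D) (hQ : ∀ ζ, ∫⁻ η, μ η ^ 2 * K (η - ζ) ^ 2 ≤ Q) :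
    (∫⁻ ζ, ∫⁻ η, f ζ * f η * K (η - ζ)) ^ 2 ≤ 2 * (D * Q) * (∫⁻ ζ, a ζ ^ 2) ^ 2 := by
  set F : Plane × Plane → ℝ≥0∞ := fun q => a q.1 * a q.2 with hF
  set k : Plane × Plane → ℝ≥0∞ := fun q => μ q.1 * ν q.1 * (μ q.2 * ν q.2) * K (q.2 - q.1)
  have hFm : Measurable F := by fun_prop
  have hkm : Measurable k := by fun_prop
  set X : Plane × Plane → ℝ≥0∞ := fun q =>
    μ q.1 ^ 2 * ν q.1 ^ 4 * (μ q.2 ^ 2 * K (q.2 - q.1) ^ 2)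
  set Y : Plane × Plane → ℝ≥0∞ := fun q =>
    μ q.2 ^ 2 * ν q.2 ^ 4 * (μ q.1 ^ 2 * K (q.1 - q.2) ^ 2)
  have hXm : Measurable X := by fun_prop
  have hYm : Measurable Y := by fun_prop
  have hX : ∫⁻ q, X q ∂(volume.prod volume) ≤ D * Q := by
    rw [lintegral_prod _ hXm.aemeasurable]
    calc _ ≤ ∫⁻ ζ, μ ζ ^ 2 * ν ζ ^ 4 * Q := by
          refine lintegral_mono fun ζ => ?_
          simp only [X]
          rw [lintegral_const_mul _ (by fun_prop)]
          gcongr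
          exact hQ ζ
      _ ≤ _ := by
          rw [lintegral_mul_const _ (by fun_prop)]
          gcongr
  have hXY : ∫⁻ q, Y q ∂(volume.prod volume) = ∫⁻ q, X q ∂(volume.prod volume) :=
    lintegral_prod_swap X
  have hk2 : ∀ q, k q ^ 2 ≤ X q + Y q := by
    intro q
    have hν2 : ν q.1 ^ 2 * ν q.2 ^ 2 ≤ ν q.1 ^ 4 + ν q.2 ^ 4 := by
      rcases le_total (ν q.1) (ν q.2) with h | h
      · calc ν q.1 ^ 2 * ν q.2 ^ 2 ≤ ν q.2 ^ 2 * ν q.2 ^ 2 := by gcongr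
          _ = ν q.2 ^ 4 := by ring
          _ ≤ _ := le_add_self
      · calc ν q.1 ^ 2 * ν q.2 ^ 2 ≤ ν q.1 ^ 2 * ν q.1 ^ 2 := by gcongr
          _ = ν q.1 ^ 4 := by ring
          _ ≤ _ := le_self_add
    have hneg : K (q.1 - q.2) = K (q.2 - q.1) := by rw [← hKneg, neg_sub]
    calc k q ^ 2 = ν q.1 ^ 2 * ν q.2 ^ 2 * (μ q.1 ^ 2 * μ q.2 ^ 2 * K (q.2 - q.1) ^ 2) := by
          simp only [k]; ring
      _ ≤ (ν q.1 ^ 4 + ν q.2 ^ 4) * (μ q.1 ^ 2 * μ q.2 ^ 2 * K (q.2 - q.1) ^ 2) := by gcongr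
      _ = X q + Y q := by simp only [X, Y]; rw [hneg]; ring
  have hF2 : ∫⁻ q, F q ^ 2 ∂(volume.prod volume) = (∫⁻ ζ, a ζ ^ 2) ^ 2 := by
    simp only [hF, mul_pow]
    rw [lintegral_prod_mul (ha.pow_const 2).aemeasurable (ha.pow_const 2).aemeasurable, sq]
  have hle : ∫⁻ ζ, ∫⁻ η, f ζ * f η * K (η - ζ) ≤ ∫⁻ q, F q * k q ∂(volume.prod volume) := by
    rw [lintegral_prod (fun q => F q * k q) (hFm.mul hkm).aemeasurable]
    refine lintegral_mono fun ζ => lintegral_mono fun η => ?_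
    calc f ζ * f η * K (η - ζ) ≤ (μ ζ * ν ζ * a ζ) * (μ η * ν η * a η) * K (η - ζ) := by
          gcongr
          · exact hf ζ
          · exact hf η
      _ = F (ζ, η) * k (ζ, η) := by simp only [F, k]; ring
  calc _ ≤ (∫⁻ q, F q * k q ∂(volume.prod volume)) ^ 2 := pow_le_pow_left' hle 2
    _ ≤ (∫⁻ q, F q ^ 2 ∂(volume.prod volume)) * ∫⁻ q, k q ^ 2 ∂(volume.prod volume) :=
        sq_lintegral_mul_le hFm.aemeasurable hkm.aemeasurable
    _ ≤ (∫⁻ ζ, a ζ ^ 2) ^ 2 * ∫⁻ q, X q + Y q ∂(volume.prod volume) := by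
        rw [hF2]; gcongr with q; exact hk2 q
    _ ≤ (∫⁻ ζ, a ζ ^ 2) ^ 2 * (D * Q + D * Q) := by
        rw [lintegral_add_left hXm, hXY]; gcongr
    _ = _ := by ring

/-- The dual form of the mixed norm estimate: `|u₁ u₂|²` is paired with a weight `W` dominated by a
function `w` of `x` alone. The kernel to which the Hilbert–Schmidt bound applies is the Fourier
transform of `W |u₁|² = ū₁ · (W u₁)`. -/
theorem sq_lintegral_weight_mul_fourierInv_le
    {g₁ g₂ : Plane → ℂ} {μ₁ μ₂ ν a₁ a₂ : Plane → ℝ≥0∞} {A B D : ℝ≥0∞}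
    (hg₁ : Integrable g₁) (hg₂ : Integrable g₂)
    (hμ₁ : Measurable μ₁) (hμ₂ : Measurable μ₂) (hν : Measurable ν)
    (ha₁ : Measurable a₁) (ha₂ : Measurable a₂)
    (hga₁ : ∀ ζ, ‖g₁ ζ‖ₑ ≤ μ₁ ζ * a₁ ζ) (hga₂ : ∀ ζ, ‖g₂ ζ‖ₑ ≤ μ₂ ζ * ν ζ * a₂ ζ)
    (hA : ∀ τ : ℝ, ∫⁻ ξ : ℝ, μ₁ !₂[ξ, τ] ^ 2 ≤ A)
    (hB : ∀ ζ, ∫⁻ η, μ₁ (ζ - η) ^ 2 * μ₂ η ^ 2 ≤ B)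
    (hD : ∫⁻ ζ, μ₂ ζ ^ 2 * ν ζ ^ 4 ≤ D)
    {W : Plane → ℝ} {w : ℝ → ℝ≥0∞} (hW : Measurable W) (hw : Measurable w)
    (hW0 : ∀ p, 0 ≤ W p) (hW1 : Integrable W) (hW2 : MemLp W 2)
    (hWw : ∀ x t : ℝ, ‖W !₂[x, t]‖ₑ ≤ w x) :
    (∫⁻ p, ‖W p‖ₑ * (‖𝓕⁻ g₁ p‖ₑ ^ 2 * ‖𝓕⁻ g₂ p‖ₑ ^ 2)) ^ 2 ≤
      2 * (A * B * D) * (∫⁻ ζ, a₁ ζ ^ 2) ^ 2 * (∫⁻ ζ, a₂ ζ ^ 2) ^ 2 * ∫⁻ x, w x ^ 2 := by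
  have hu₁ := continuous_fourierInv hg₁
  have hu₂ := continuous_fourierInv hg₂
  set φ : Plane → ℂ := fun p => 𝓕⁻ g₁ p * (W p : ℂ)
  have hφ1 : Integrable φ :=
    (hW1.ofReal (𝕜 := ℂ)).bdd_mul (c := ∫ v, ‖g₁ v‖) hu₁.aestronglyMeasurable
      (Filter.Eventually.of_forall fun p => norm_fourierInv_le p)
  have hφ2 : MemLp φ 2 := by
    refine MemLp.of_le_mul (c := ∫ v, ‖g₁ v‖) hW2 hφ1.1 (Filter.Eventually.of_forall fun p => ?_)
    simp only [φ, norm_mul, Complex.norm_real]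
    gcongr
    exact norm_fourierInv_le p
  set h : Plane → ℂ := fun p => starRingEnd ℂ (𝓕⁻ g₁ p) * φ p
  have hh1 : Integrable h := integrable_conj_fourierInv_mul hg₁ hφ1
  have hh : ∀ p, h p = ((W p * ‖𝓕⁻ g₁ p‖ ^ 2 : ℝ) : ℂ) := by
    intro p
    simp only [h, φ]
    rw [← mul_assoc, mul_comm (starRingEnd ℂ _), Complex.mul_conj, Complex.normSq_eq_norm_sq]
    push_cast; ring
  have hΦ : ∫⁻ ζ, ‖𝓕 φ ζ‖ₑ ^ 2 ≤ A * (∫⁻ ζ, a₁ ζ ^ 2) * ∫⁻ x, w x ^ 2 := by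
    rw [lintegral_fourier_sq hφ1 hφ2, lintegral_plane (by fun_prop),
      ← lintegral_const_mul _ (by fun_prop)]
    refine lintegral_mono fun x => ?_
    calc ∫⁻ t : ℝ, ‖φ !₂[x, t]‖ₑ ^ 2 ≤ ∫⁻ t : ℝ, ‖𝓕⁻ g₁ !₂[x, t]‖ₑ ^ 2 * w x ^ 2 := by
          refine lintegral_mono fun t => ?_
          simp only [φ]
          rw [enorm_mul, mul_pow]
          gcongr
          rw [← ofReal_norm, Complex.norm_real, ofReal_norm]
          exact hWw x t
      _ = (∫⁻ t : ℝ, ‖𝓕⁻ g₁ !₂[x, t]‖ₑ ^ 2) * w x ^ 2 :=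
          lintegral_mul_const _ ((hu₁.comp (continuous_mk_right x)).measurable.enorm.pow_const 2)
      _ ≤ _ := by
          gcongr
          exact lintegral_fourierInv_vertical_le hg₁ hμ₁ ha₁ hga₁ hA x
  have hQ : ∀ ζ, ∫⁻ η, μ₂ η ^ 2 * ‖𝓕 h (η - ζ)‖ₑ ^ 2 ≤
      B * (∫⁻ ζ, a₁ ζ ^ 2) * (A * (∫⁻ ζ, a₁ ζ ^ 2) * ∫⁻ x, w x ^ 2) := by
    intro ζ
    refine le_trans (lintegral_mono fun η => ?_)
      ((lintegral_weight_mul_correlation_le hμ₁ hμ₂ ha₁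
        (continuous_fourier hφ1).measurable.enorm hga₁ hB ζ).trans (by gcongr))
    gcongr
    exact enorm_fourier_conj_fourierInv_mul_le hg₁ hφ1 _
  have hlhs : ∫⁻ p, ‖W p‖ₑ * (‖𝓕⁻ g₁ p‖ₑ ^ 2 * ‖𝓕⁻ g₂ p‖ₑ ^ 2) =
      ‖∫ p, 𝓕⁻ g₂ p * (starRingEnd ℂ (𝓕⁻ g₂ p) * h p)‖ₑ := by
    have hpt : ∀ p, 𝓕⁻ g₂ p * (starRingEnd ℂ (𝓕⁻ g₂ p) * h p) =
        ((W p * (‖𝓕⁻ g₁ p‖ ^ 2 * ‖𝓕⁻ g₂ p‖ ^ 2) : ℝ) : ℂ) := by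
      intro p
      rw [← mul_assoc, Complex.mul_conj, Complex.normSq_eq_norm_sq, hh]
      push_cast; ring
    have hint : Integrable fun p => 𝓕⁻ g₂ p * (starRingEnd ℂ (𝓕⁻ g₂ p) * h p) :=
      (integrable_conj_fourierInv_mul hg₂ hh1).bdd_mul (c := ∫ v, ‖g₂ v‖)
        hu₂.aestronglyMeasurable (Filter.Eventually.of_forall fun p => norm_fourierInv_le p)
    have hnn : ∀ p, 0 ≤ W p * (‖𝓕⁻ g₁ p‖ ^ 2 * ‖𝓕⁻ g₂ p‖ ^ 2) := fun p =>
      mul_nonneg (hW0 p) (by positivity)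
    simp only [hpt] at hint ⊢
    have hre : Integrable fun p => W p * (‖𝓕⁻ g₁ p‖ ^ 2 * ‖𝓕⁻ g₂ p‖ ^ 2) := hint.re
    rw [integral_complex_ofReal, ← ofReal_norm, Complex.norm_real, Real.norm_of_nonneg
      (integral_nonneg hnn), ofReal_integral_eq_lintegral_ofReal hre
      (Filter.Eventually.of_forall hnn)]
    refine lintegral_congr fun p => ?_
    rw [ENNReal.ofReal_mul (hW0 p), ENNReal.ofReal_mul (by positivity),
      ENNReal.ofReal_pow (norm_nonneg _), ENNReal.ofReal_pow (norm_nonneg _), ofReal_norm,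
      ofReal_norm, Real.enorm_of_nonneg (hW0 p)]
  rw [hlhs]
  refine (pow_le_pow_left' (enorm_integral_normSq_fourierInv_le hg₂ hh1) 2).trans ?_
  refine (sq_lintegral_kernel_le hμ₂ hν ha₂ (continuous_fourier hh1).measurable.enorm hga₂
    (enorm_fourier_neg fun p => by rw [hh, Complex.conj_ofReal]) hD hQ).trans_eq ?_
  ring

theorem mixedNorm_pow_four (T : Set ℝ) (f : Plane → ℂ) :
    mixedNorm T f ^ 4 = ∫⁻ x : ℝ, (∫⁻ t in T, ‖f !₂[x, t]‖ₑ ^ 2) ^ 2 := by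
  have h := eLpNorm_natCast_pow (μ := (volume : Measure ℝ))
    (fun x : ℝ => eLpNorm (fun t : ℝ => f !₂[x, t]) 2 (volume.restrict T)) (n := 4) (by norm_num)
  rw [mixedNorm]
  refine (Eq.trans ?_ h).trans ?_
  · norm_num
  · refine lintegral_congr fun x => ?_
    rw [enorm_eq_self, ← eLpNorm_two_sq, ← pow_mul]

/-- A nonnegative function `G` whose square is controlled through duality: if pairing `G` with
each of its truncations `w = min(G, n) 1_{[-n,n]}` gives at most `(K ∫ w²)^{1/2}`, then
`∫ G² ≤ K`. No integrability of `G` is needed in advance. -/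
theorem lintegral_sq_le_of_truncations {G : ℝ → ℝ≥0∞} (hG : Measurable G) {K : ℝ≥0∞}
    (h : ∀ n : ℕ, (∫⁻ x, (indicator (Icc (-n : ℝ) n) (fun x => min (G x) n) x) * G x) ^ 2 ≤
      K * ∫⁻ x, (indicator (Icc (-n : ℝ) n) (fun x => min (G x) n) x) ^ 2) :
    ∫⁻ x, G x ^ 2 ≤ K := by
  set w : ℕ → ℝ → ℝ≥0∞ := fun n => indicator (Icc (-n : ℝ) n) (fun x => min (G x) n) with hw
  have hwm : ∀ n, Measurable (w n) := fun n =>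
    (hG.min measurable_const).indicator measurableSet_Icc
  have hwG : ∀ n x, w n x ≤ G x := fun n x =>
    indicator_le_self' (fun _ _ => zero_le) x |>.trans (min_le_left _ _)
  have hfin : ∀ n, ∫⁻ x, w n x ^ 2 ≠ ∞ := by
    intro n
    have h1 : ∀ x, w n x ^ 2 ≤ indicator (Icc (-n : ℝ) n) (fun _ => (n : ℝ≥0∞) ^ 2) x := by
      intro x
      by_cases hx : x ∈ Icc (-n : ℝ) n
      · simp only [hw, indicator_of_mem hx]
        gcongr
        exact min_le_right _ _
      · simp [hw, indicator_of_notMem hx]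
    refine ((lintegral_mono h1).trans_lt ?_).ne
    rw [lintegral_indicator measurableSet_Icc, setLIntegral_const]
    exact ENNReal.mul_lt_top (by simp) (by simp)
  have hle : ∀ n, ∫⁻ x, w n x ^ 2 ≤ K := by
    intro n
    have h1 : ∫⁻ x, w n x ^ 2 ≤ ∫⁻ x, w n x * G x := lintegral_mono fun x => by
      rw [sq]; gcongr; exact hwG n x
    have h2 := (pow_le_pow_left' h1 2).trans (h n)
    rcases eq_or_ne (∫⁻ x, w n x ^ 2) 0 with h0 | h0
    · rw [h0]; exact zero_le
    · rw [sq] at h2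
      exact (ENNReal.mul_le_mul_iff_left h0 (hfin n)).1 h2
  have hmono : Monotone fun n x => w n x ^ 2 := by
    intro m n hmn x
    have hmn' : (m : ℝ) ≤ n := by exact_mod_cast hmn
    have hmn'' : (m : ℝ≥0∞) ≤ n := by exact_mod_cast hmn
    have : w m x ≤ w n x := by
      by_cases hx : x ∈ Icc (-m : ℝ) m
      · have hx' : x ∈ Icc (-n : ℝ) n := ⟨by linarith [hx.1], by linarith [hx.2]⟩
        simp only [hw, indicator_of_mem hx, indicator_of_mem hx']
        exact min_le_min_left _ hmn''
      · simp [hw, indicator_of_notMem hx]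
    exact pow_le_pow_left' this 2
  have hsup : ∀ x, G x ^ 2 ≤ ⨆ n, w n x ^ 2 := by
    intro x
    obtain ⟨m, hm⟩ := exists_nat_ge |x|
    have hmem : ∀ n ≥ m, x ∈ Icc (-n : ℝ) n := fun n hn => by
      have : (m : ℝ) ≤ n := by exact_mod_cast hn
      exact abs_le.1 (hm.trans this)
    rcases eq_or_ne (G x) ∞ with htop | htop
    · rw [htop, ENNReal.top_pow two_ne_zero, top_le_iff, iSup_eq_top]
      intro b hb
      obtain ⟨k, hk⟩ := ENNReal.exists_nat_gt hb.ne
      refine ⟨max m (k + 1), ?_⟩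
      simp only [hw, indicator_of_mem (hmem _ (le_max_left _ _)), htop]
      rw [min_eq_right le_top]
      refine hk.trans_le ?_
      have : k ≤ (max m (k + 1)) ^ 2 := by
        have := le_max_right m (k + 1)
        nlinarith
      exact_mod_cast this
    · obtain ⟨k, hk⟩ := ENNReal.exists_nat_gt htop
      refine le_iSup_of_le (max m k) ?_
      have hk' : G x ≤ ((max m k : ℕ) : ℝ≥0∞) :=
        hk.le.trans (by exact_mod_cast le_max_right m k)
      simp only [hw, indicator_of_mem (hmem _ (le_max_left _ _))]
      rw [min_eq_left hk']
  calc ∫⁻ x, G x ^ 2 ≤ ∫⁻ x, ⨆ n, w n x ^ 2 := lintegral_mono hsup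
    _ = ⨆ n, ∫⁻ x, w n x ^ 2 := lintegral_iSup (fun n => (hwm n).pow_const 2) hmono
    _ ≤ K := iSup_le hle

/-- The bilinear estimate in terms of the frequency weights. The `L⁴ₓL²_t` norm is recovered by
testing `|u₁ u₂|²` against its own integral in `t`, truncated so as to be integrable. -/
theorem mixedNorm_fourierInv_mul_pow_four_le
    {g₁ g₂ : Plane → ℂ} {μ₁ μ₂ ν a₁ a₂ : Plane → ℝ≥0∞} {A B D : ℝ≥0∞}
    (hg₁ : Integrable g₁) (hg₂ : Integrable g₂)
    (hμ₁ : Measurable μ₁) (hμ₂ : Measurable μ₂) (hν : Measurable ν)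
    (ha₁ : Measurable a₁) (ha₂ : Measurable a₂)
    (hga₁ : ∀ ζ, ‖g₁ ζ‖ₑ ≤ μ₁ ζ * a₁ ζ) (hga₂ : ∀ ζ, ‖g₂ ζ‖ₑ ≤ μ₂ ζ * ν ζ * a₂ ζ)
    (hA : ∀ τ : ℝ, ∫⁻ ξ : ℝ, μ₁ !₂[ξ, τ] ^ 2 ≤ A)
    (hB : ∀ ζ, ∫⁻ η, μ₁ (ζ - η) ^ 2 * μ₂ η ^ 2 ≤ B)
    (hD : ∫⁻ ζ, μ₂ ζ ^ 2 * ν ζ ^ 4 ≤ D) :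
    mixedNorm univ (fun p => 𝓕⁻ g₁ p * 𝓕⁻ g₂ p) ^ 4 ≤
      2 * (A * B * D) * (∫⁻ ζ, a₁ ζ ^ 2) ^ 2 * (∫⁻ ζ, a₂ ζ ^ 2) ^ 2 := by
  have hu₁ := continuous_fourierInv hg₁
  have hu₂ := continuous_fourierInv hg₂
  set f : Plane → ℝ≥0∞ := fun p => ‖𝓕⁻ g₁ p‖ₑ ^ 2 * ‖𝓕⁻ g₂ p‖ₑ ^ 2 with hf
  have hfm : Measurable f := by
    have := hu₁.measurable
    have := hu₂.measurable
    fun_prop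
  have hfs : ∀ x : ℝ, Measurable fun t : ℝ => f !₂[x, t] := fun x =>
    hfm.comp (measurable_mk_right x)
  set G : ℝ → ℝ≥0∞ := fun x => ∫⁻ t : ℝ, f !₂[x, t] with hG
  have hGm : Measurable G := (hfm.comp measurable_mk).lintegral_prod_right'
  rw [mixedNorm_pow_four]
  simp only [Measure.restrict_univ, enorm_mul, mul_pow]
  refine lintegral_sq_le_of_truncations hGm fun n => ?_
  set w : ℝ → ℝ≥0∞ := indicator (Icc (-n : ℝ) n) (fun x => min (G x) n) with hw
  have hwm : Measurable w := (hGm.min measurable_const).indicator measurableSet_Icc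
  have hwn : ∀ x, w x ≤ n := fun x =>
    (indicator_le_self' (fun _ _ => zero_le) x).trans (min_le_right _ _)
  have hw_top : ∀ x, w x ≠ ∞ := fun x => ((hwn x).trans_lt (ENNReal.natCast_lt_top n)).ne
  -- The weight has to be truncated in time as well; the truncation is removed by monotone
  -- convergence.
  have key : ∀ m : ℕ, (∫⁻ x, w x * ∫⁻ t in Icc (-m : ℝ) m, f !₂[x, t]) ^ 2 ≤
      2 * (A * B * D) * (∫⁻ ζ, a₁ ζ ^ 2) ^ 2 * (∫⁻ ζ, a₂ ζ ^ 2) ^ 2 * ∫⁻ x, w x ^ 2 := by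
    intro m
    set S : Set Plane := {p | p 0 ∈ Icc (-n : ℝ) n ∧ p 1 ∈ Icc (-m : ℝ) m} with hS
    have h0 : Measurable fun p : Plane => p 0 := by fun_prop
    have h1 : Measurable fun p : Plane => p 1 := by fun_prop
    have hSm : MeasurableSet S := (h0 measurableSet_Icc).inter (h1 measurableSet_Icc)
    have hSfin : volume S < ∞ := by
      refine (Metric.isBounded_iff_subset_closedBall 0).2 ⟨n + m, fun p hp => ?_⟩
        |>.measure_lt_top
      rw [mem_closedBall_zero_iff, EuclideanSpace.norm_eq, Fin.sum_univ_two]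
      have e0 : |p 0| ≤ n := abs_le.2 hp.1
      have e1 : |p 1| ≤ m := abs_le.2 hp.2
      refine Real.sqrt_le_iff.2 ⟨by positivity, ?_⟩
      rw [Real.norm_eq_abs, Real.norm_eq_abs]
      nlinarith [abs_nonneg (p 0), abs_nonneg (p 1)]
    set W : Plane → ℝ := S.indicator fun p => (w (p 0)).toReal with hW
    have hWm : Measurable W := ((hwm.comp h0).ennreal_toReal).indicator hSm
    have hW0 : ∀ p, 0 ≤ W p := fun p => indicator_nonneg (fun _ _ => ENNReal.toReal_nonneg) p
    have hWn : ∀ p, ‖W p‖ ≤ n := by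
      intro p
      rw [Real.norm_of_nonneg (hW0 p)]
      refine (indicator_le_self' (fun _ _ => ENNReal.toReal_nonneg) p).trans ?_
      simpa using ENNReal.toReal_mono (ENNReal.natCast_ne_top n) (hwn (p 0))
    have hWLp : ∀ q : ℝ≥0∞, MemLp W q := by
      intro q
      have : MemLp (fun p : Plane => (w (p 0)).toReal) q (volume.restrict S) := by
        have : IsFiniteMeasure ((volume : Measure Plane).restrict S) :=
          ⟨by rwa [Measure.restrict_apply_univ]⟩
        refine MemLp.of_bound (hwm.comp h0).ennreal_toReal.aestronglyMeasurable n
          (Filter.Eventually.of_forall fun p => ?_)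
        rw [Real.norm_of_nonneg ENNReal.toReal_nonneg]
        simpa using ENNReal.toReal_mono (ENNReal.natCast_ne_top n) (hwn (p 0))
      exact (memLp_indicator_iff_restrict hSm).2 this
    have hWe : ∀ x t : ℝ, ‖W !₂[x, t]‖ₑ = indicator (Icc (-m : ℝ) m) (fun _ => w x) t := by
      intro x t
      by_cases ht : t ∈ Icc (-m : ℝ) m
      · by_cases hx : x ∈ Icc (-n : ℝ) n
        · have hp : (!₂[x, t] : Plane) ∈ S := ⟨hx, ht⟩
          rw [hW, indicator_of_mem hp, indicator_of_mem ht,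
            Real.enorm_of_nonneg ENNReal.toReal_nonneg, ENNReal.ofReal_toReal (hw_top _)]
          rfl
        · have hp : (!₂[x, t] : Plane) ∉ S := fun h => hx h.1
          rw [hW, indicator_of_notMem hp, indicator_of_mem ht, hw, indicator_of_notMem hx,
            enorm_zero]
      · have hp : (!₂[x, t] : Plane) ∉ S := fun h => ht h.2
        rw [hW, indicator_of_notMem hp, indicator_of_notMem ht, enorm_zero]
    have hmain := sq_lintegral_weight_mul_fourierInv_le hg₁ hg₂ hμ₁ hμ₂ hν ha₁ ha₂ hga₁ hga₂ hA hB
      hD hWm hwm hW0 (memLp_one_iff_integrable.1 (hWLp 1)) (hWLp 2) (fun x t => by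
        rw [hWe]; exact indicator_le_self' (fun _ _ => zero_le) t)
    refine le_trans (le_of_eq ?_) hmain
    congr 1
    rw [lintegral_plane (by fun_prop)]
    refine lintegral_congr fun x => ?_
    rw [← lintegral_const_mul _ (hfs x), ← lintegral_indicator measurableSet_Icc]
    refine lintegral_congr fun t => ?_
    rw [hWe]
    by_cases ht : t ∈ Icc (-m : ℝ) m
    · simp [indicator_of_mem ht, hf]
    · simp [indicator_of_notMem ht]
  have hmono : ∀ x, Monotone fun m : ℕ => ∫⁻ t in Icc (-m : ℝ) m, f !₂[x, t] := by
    intro x m k hmk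
    have : (m : ℝ) ≤ k := by exact_mod_cast hmk
    exact lintegral_mono_set (Icc_subset_Icc (by linarith) this)
  have hsup : ∀ x, ⨆ m : ℕ, ∫⁻ t in Icc (-m : ℝ) m, f !₂[x, t] = G x := by
    intro x
    have hdir : Directed (· ⊆ ·) fun m : ℕ => Icc (-m : ℝ) m :=
      Monotone.directed_le fun m k hmk => by
        have : (m : ℝ) ≤ k := by exact_mod_cast hmk
        exact Icc_subset_Icc (by linarith) this
    rw [← setLIntegral_iUnion_of_directed _ hdir, hG]
    have : ⋃ m : ℕ, Icc (-m : ℝ) m = univ := by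
      refine eq_univ_of_forall fun t => ?_
      obtain ⟨m, hm⟩ := exists_nat_ge |t|
      exact mem_iUnion.2 ⟨m, abs_le.1 hm⟩
    rw [this, Measure.restrict_univ]
  have hconv : ∫⁻ x, w x * G x = ⨆ m : ℕ, ∫⁻ x, w x * ∫⁻ t in Icc (-m : ℝ) m, f !₂[x, t] := by
    rw [← lintegral_iSup]
    · refine lintegral_congr fun x => ?_
      rw [← ENNReal.mul_iSup, hsup]
    · intro m
      exact hwm.mul (hfm.comp measurable_mk).lintegral_prod_right'
    · intro m k hmk x
      have := hmono x hmk
      dsimp only at this ⊢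
      gcongr
  rw [hconv, ENNReal.iSup_pow_of_ne_zero two_ne_zero]
  exact iSup_le key

/-! ### The frequency weights -/

theorem bracket_pos (y : ℝ) : 0 < bracket y := by
  unfold bracket; positivity

theorem one_le_bracket (y : ℝ) : 1 ≤ bracket y := by
  unfold bracket; linarith [abs_nonneg y]

theorem continuous_bracket : Continuous bracket := by
  unfold bracket; fun_prop

/-- The function `y ↦ ⟨y⟩⁻ᵖ`, with values in `[0, ∞]`. -/
noncomputable def decay (p : ℝ) (y : ℝ) : ℝ≥0∞ := ENNReal.ofReal (bracket y ^ (-p))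

theorem measurable_decay (p : ℝ) : Measurable (decay p) :=
  (continuous_bracket.rpow_const
    fun y => Or.inl (bracket_pos y).ne').measurable.ennreal_ofReal

theorem decay_pow (p : ℝ) (n : ℕ) (y : ℝ) : decay p y ^ n = decay (n * p) y := by
  rw [decay, decay, ← ENNReal.ofReal_pow (rpow_nonneg (bracket_pos y).le _), ← rpow_natCast,
    ← rpow_mul (bracket_pos y).le]
  congr 2; ring

theorem lintegral_decay {p : ℝ} (hp : 1 < p) :
    ∫⁻ y, decay p y = ENNReal.ofReal (2 / (p - 1)) := by
  have hIoi : ∫⁻ y in Ioi (0 : ℝ), decay p y = ENNReal.ofReal (1 / (p - 1)) := by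
    have h1 : ∫⁻ y in Ioi (0 : ℝ), decay p y =
        ∫⁻ y in Ioi (0 : ℝ), ENNReal.ofReal ((y + 1) ^ (-p)) := by
      refine setLIntegral_congr_fun measurableSet_Ioi fun y hy => ?_
      simp only [decay, bracket]
      rw [abs_of_pos hy, add_comm]
    have h2 := (measurePreserving_add_right volume (1 : ℝ)).setLIntegral_comp_preimage_emb
      (MeasurableEquiv.addRight (1 : ℝ)).measurableEmbedding
      (fun y : ℝ => ENNReal.ofReal (y ^ (-p))) (Ioi 1)
    rw [preimage_add_const_Ioi, sub_self] at h2
    rw [h1, h2, ← ofReal_integral_eq_lintegral_ofReal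
      (integrableOn_Ioi_rpow_of_lt (neg_lt_neg hp) one_pos)
      ((ae_restrict_iff' measurableSet_Ioi).2 (Filter.Eventually.of_forall fun y hy =>
        rpow_nonneg (zero_le_one.trans (mem_Ioi.1 hy).le) _)),
      integral_Ioi_rpow_of_lt (neg_lt_neg hp) one_pos, one_rpow]
    congr 1
    rw [show -p + 1 = -(p - 1) by ring, neg_div_neg_eq]
  have hIio : ∫⁻ y in Iio (0 : ℝ), decay p y = ∫⁻ y in Ioi (0 : ℝ), decay p y := by
    have h2 := (Measure.measurePreserving_neg (volume : Measure ℝ)).setLIntegral_comp_preimage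
      (measurableSet_Ioi (a := (0 : ℝ))) (measurable_decay p)
    rw [← h2]
    have h3 : (Neg.neg ⁻¹' Ioi (0 : ℝ)) = Iio 0 := by ext y; simp
    rw [h3]
    simp [decay, bracket]
  rw [← lintegral_add_compl _ (measurableSet_Ioi (a := (0 : ℝ))), compl_Ioi,
    setLIntegral_congr Iio_ae_eq_Iic.symm, hIio, hIoi, ← ENNReal.ofReal_add] 
  · congr 1; ring
  all_goals
    exact div_nonneg zero_le_one (by linarith)

/-- The weight `⟨x⟩⁻ᵖ ⟨y⟩⁻ᵖ` is small when `x + y` is large, since one of `|x|`, `|y|` is then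
at least half as large. -/
theorem decay_mul_decay_le {p : ℝ} (hp : 0 ≤ p) (x y : ℝ) :
    decay p x * decay p y ≤
      ENNReal.ofReal (2 ^ p) * decay p (x + y) * (decay p x + decay p y) := by
  have aux : ∀ x y : ℝ, |y| ≤ |x| →
      decay p x ≤ ENNReal.ofReal (2 ^ p) * decay p (x + y) := by
    intro x y hxy
    rw [decay, decay, ← ENNReal.ofReal_mul (by positivity)]
    refine ENNReal.ofReal_le_ofReal ?_
    have h1 : bracket (x + y) ≤ 2 * bracket x := by
      unfold bracket
      linarith [abs_add_le x y]
    have h2 : (2 * bracket x) ^ (-p) ≤ bracket (x + y) ^ (-p) :=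
      rpow_le_rpow_of_nonpos (bracket_pos _) h1 (by linarith)
    calc bracket x ^ (-p) = 2 ^ p * (2 * bracket x) ^ (-p) := by
          rw [mul_rpow zero_le_two (bracket_pos x).le, ← mul_assoc, ← rpow_add two_pos]
          simp
      _ ≤ _ := by gcongr
  rcases le_total |y| |x| with h | h
  · calc _ ≤ ENNReal.ofReal (2 ^ p) * decay p (x + y) * decay p y := by gcongr; exact aux x y h
      _ ≤ _ := by gcongr; exact le_add_self
  · calc _ = decay p y * decay p x := mul_comm _ _
      _ ≤ ENNReal.ofReal (2 ^ p) * decay p (y + x) * decay p x := by gcongr; exact aux y x h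
      _ ≤ _ := by rw [add_comm y x]; gcongr; exact le_self_add

/-- Change of variables along a function whose derivative is bounded below. -/
theorem setLIntegral_comp_le_of_le_abs_deriv {S : Set ℝ} (hS : MeasurableSet S) {f f' : ℝ → ℝ}
    (hf : ∀ x, HasDerivAt f (f' x) x) (hinj : InjOn f S) {l : ℝ} (hl : 0 < l)
    (hf' : ∀ x ∈ S, l ≤ |f' x|) (φ : ℝ → ℝ≥0∞) :
    ∫⁻ x in S, φ (f x) ≤ ENNReal.ofReal (1 / l) * ∫⁻ y, φ y := by
  have h1 := lintegral_image_eq_lintegral_abs_deriv_mul hS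
    (fun x _ => (hf x).hasDerivWithinAt) hinj φ
  have h2 : ENNReal.ofReal l * ∫⁻ x in S, φ (f x) ≤ ∫⁻ y, φ y := by
    rw [← lintegral_const_mul' _ _ ENNReal.ofReal_ne_top]
    refine le_trans ?_ (setLIntegral_le_lintegral (f '' S) φ)
    rw [h1]
    refine setLIntegral_mono' hS fun x hx => ?_
    gcongr
    exact hf' x hx
  calc ∫⁻ x in S, φ (f x)
      = ENNReal.ofReal (1 / l) * (ENNReal.ofReal l * ∫⁻ x in S, φ (f x)) := by
        rw [← mul_assoc, ← ENNReal.ofReal_mul (by positivity), one_div_mul_cancel hl.ne']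
        simp
    _ ≤ _ := by gcongr

/-- The reciprocal `⟨τ - bξ³⟩^{-β}` of the weight of `X_{0,β}`, cut off to the frequency strip
`ξ ∈ S`. The argument `ζ` is the variable of the transform with kernel `e^{-2πi(xξ+tτ)}`, which
is why the frequencies are `2π • ζ`. -/
noncomputable def stripWeight (b β : ℝ) (S : Set ℝ) (ζ : Plane) : ℝ≥0∞ :=
  indicator S (fun _ => decay β (2 * π * ζ 1 - b * (2 * π * ζ 0) ^ 3)) (2 * π * ζ 0)

theorem measurable_stripWeight (b β : ℝ) {S : Set ℝ} (hS : MeasurableSet S) :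
    Measurable (stripWeight b β S) := by
  have h0 : Measurable fun ζ : Plane => 2 * π * ζ 0 := by fun_prop
  have h1 : Measurable fun ζ : Plane => 2 * π * ζ 1 - b * (2 * π * ζ 0) ^ 3 := by fun_prop
  exact ((measurable_decay β).comp h1).indicator (h0 hS)

theorem stripWeight_sq (b β : ℝ) (S : Set ℝ) (ζ : Plane) :
    stripWeight b β S ζ ^ 2 = indicator S
      (fun _ => decay (2 * β) (2 * π * ζ 1 - b * (2 * π * ζ 0) ^ 3)) (2 * π * ζ 0) := by
  by_cases h : 2 * π * ζ 0 ∈ S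
  · rw [stripWeight, indicator_of_mem h, indicator_of_mem h, decay_pow]; norm_num
  · rw [stripWeight, indicator_of_notMem h, indicator_of_notMem h]; simp

/-- A rescaling of the line by `2π`, followed by a translation. -/
theorem lintegral_comp_two_pi_mul_add_le (φ : ℝ → ℝ≥0∞) (d : ℝ) :
    ∫⁻ y, φ (2 * π * y + d) ≤ ENNReal.ofReal (1 / (2 * π)) * ∫⁻ y, φ y := by
  have h := setLIntegral_comp_le_of_le_abs_deriv (S := univ) MeasurableSet.univ
    (f := fun y => 2 * π * y + d) (f' := fun _ => 2 * π)
    (fun y => by simpa using ((hasDerivAt_id y).const_mul (2 * π)).add_const d)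
    (fun x _ y _ hxy => by simpa [pi_ne_zero] using hxy) two_pi_pos
    (fun _ _ => le_abs_self _) φ
  simpa using h

/-- Local smoothing for the weights: `∂_ξ (bξ³)` is at least `3|b|r²` where `|ξ| ≥ r`. -/
theorem lintegral_stripWeight_sq_horizontal_le {b β r : ℝ} (hb : b ≠ 0) (hr : 0 < r) {S : Set ℝ}
    (hS : MeasurableSet S) (hSr : ∀ y ∈ S, r ≤ |y|) (τ : ℝ) :
    ∫⁻ ξ : ℝ, stripWeight b β S !₂[ξ, τ] ^ 2 ≤
      ENNReal.ofReal (1 / (6 * π * |b| * r ^ 2)) * ∫⁻ y, decay (2 * β) y := by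
  have hT : MeasurableSet ((fun ξ : ℝ => 2 * π * ξ) ⁻¹' S) :=
    (measurable_const_mul (2 * π)) hS
  have hder : ∀ ξ : ℝ, HasDerivAt (fun ξ : ℝ => 2 * π * τ - b * (2 * π * ξ) ^ 3)
      (-(b * (3 * (2 * π * ξ) ^ 2 * (2 * π)))) ξ := by
    intro ξ
    have h1 : HasDerivAt (fun ξ : ℝ => 2 * π * ξ) (2 * π) ξ := by
      simpa using (hasDerivAt_id ξ).const_mul (2 * π)
    simpa using ((h1.pow 3).const_mul b).const_sub (2 * π * τ)
  have hinj : InjOn (fun ξ : ℝ => 2 * π * τ - b * (2 * π * ξ) ^ 3)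
      ((fun ξ : ℝ => 2 * π * ξ) ⁻¹' S) := by
    intro x _ y _ hxy
    have h1 : b * (2 * π * x) ^ 3 = b * (2 * π * y) ^ 3 := by
      simp only at hxy; linarith
    have h2 := (Odd.strictMono_pow (by decide : Odd 3)).injective (mul_left_cancel₀ hb h1)
    exact mul_left_cancel₀ two_pi_pos.ne' h2
  have h := setLIntegral_comp_le_of_le_abs_deriv hT hder hinj (l := 6 * π * |b| * r ^ 2)
    (by positivity) (fun ξ hξ => by
      have h1 : r ^ 2 ≤ (2 * π * ξ) ^ 2 := by
        rw [← sq_abs (2 * π * ξ)]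
        exact pow_le_pow_left₀ hr.le (hSr _ hξ) 2
      rw [abs_neg, abs_mul, abs_of_nonneg (by positivity : 0 ≤ 3 * (2 * π * ξ) ^ 2 * (2 * π))]
      calc 6 * π * |b| * r ^ 2 ≤ 6 * π * |b| * (2 * π * ξ) ^ 2 := by gcongr
        _ = _ := by ring) (decay (2 * β))
  refine le_trans (le_of_eq ?_) h
  rw [← lintegral_indicator hT]
  refine lintegral_congr fun ξ => ?_
  rw [stripWeight_sq]
  rfl

/-- The convolution estimate behind the bilinear `L²` bound. The resonance function
`ξ ↦ b(ξ₀ - ξ)³ + bξ³` has derivative `3b(ξ² - (ξ₀ - ξ)²)` and is injective where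
`|ξ₀ - ξ| > |ξ|`. -/
theorem lintegral_stripWeight_convolution_le {b β l : ℝ} (hb : b ≠ 0) (hβ : 0 ≤ β) (hl : 0 < l)
    {S₁ S₂ : Set ℝ} (hS₁ : MeasurableSet S₁) (hS₂ : MeasurableSet S₂)
    (hS : ∀ y ∈ S₁, ∀ z ∈ S₂, l ≤ y ^ 2 - z ^ 2) (ζ : Plane) :
    ∫⁻ η, stripWeight b β S₁ (ζ - η) ^ 2 * stripWeight b β S₂ η ^ 2 ≤
      ENNReal.ofReal (2 ^ (2 * β)) * (2 * (ENNReal.ofReal (1 / (2 * π)) * ∫⁻ y, decay (2 * β) y)) *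
        (ENNReal.ofReal (1 / (6 * π * |b| * l)) * ∫⁻ y, decay (2 * β) y) := by
  set J := ∫⁻ y, decay (2 * β) y with hJ
  have hm₁ := measurable_stripWeight b β hS₁
  have hm₂ := measurable_stripWeight b β hS₂
  set T : Set ℝ := {ξ | 2 * π * (ζ 0 - ξ) ∈ S₁ ∧ 2 * π * ξ ∈ S₂} with hTdef
  have hT : MeasurableSet T :=
    ((by fun_prop : Measurable fun ξ : ℝ => 2 * π * (ζ 0 - ξ)) hS₁).inter
      ((by fun_prop : Measurable fun ξ : ℝ => 2 * π * ξ) hS₂)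
  set f : ℝ → ℝ := fun ξ =>
    2 * π * ζ 1 - b * (2 * π * (ζ 0 - ξ)) ^ 3 - b * (2 * π * ξ) ^ 3 with hf
  have hder : ∀ ξ : ℝ, HasDerivAt f
      (6 * π * b * ((2 * π * (ζ 0 - ξ)) ^ 2 - (2 * π * ξ) ^ 2)) ξ := by
    intro ξ
    have h1 : HasDerivAt (fun ξ : ℝ => 2 * π * ξ) (2 * π) ξ := by
      simpa using (hasDerivAt_id ξ).const_mul (2 * π)
    have h2 : HasDerivAt (fun ξ : ℝ => 2 * π * (ζ 0 - ξ)) (2 * π * (-1)) ξ :=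
      ((hasDerivAt_id ξ).const_sub (ζ 0)).const_mul (2 * π)
    have h3 := (((h2.pow 3).const_mul b).const_sub (2 * π * ζ 1)).sub ((h1.pow 3).const_mul b)
    refine h3.congr_deriv ?_
    push_cast
    ring
  have hinj : InjOn f T := by
    intro y hy z hz hyz
    have h1 : ∀ ξ ∈ T, 0 < ζ 0 * (ζ 0 - 2 * ξ) := by
      intro ξ hξ
      have h2 := hS _ hξ.1 _ hξ.2
      have h3 : 0 < (2 * π) ^ 2 * (ζ 0 * (ζ 0 - 2 * ξ)) := by
        refine hl.trans_le (h2.trans_eq ?_); ring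
      exact pos_of_mul_pos_right h3 (by positivity)
    have h2 : b * (2 * π) ^ 3 * (3 * (ζ 0 * (ζ 0 - y - z))) * (y - z) = 0 := by
      simp only [hf] at hyz
      linear_combination hyz
    have h3 : ζ 0 * (ζ 0 - y - z) ≠ 0 := by
      have := h1 y hy
      have := h1 z hz
      nlinarith
    have h4 : b * (2 * π) ^ 3 * (3 * (ζ 0 * (ζ 0 - y - z))) ≠ 0 :=
      mul_ne_zero (mul_ne_zero hb (pow_ne_zero _ two_pi_pos.ne')) (mul_ne_zero three_ne_zero h3)
    exact sub_eq_zero.1 ((mul_eq_zero.1 h2).resolve_left h4)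
  have hmain := setLIntegral_comp_le_of_le_abs_deriv hT hder hinj (l := 6 * π * |b| * l)
    (by positivity) (fun ξ hξ => by
      have h2 := hS _ hξ.1 _ hξ.2
      rw [abs_mul, abs_mul, abs_of_pos (by positivity : 0 < 6 * π)]
      gcongr
      exact h2.trans (le_abs_self _)) (decay (2 * β))
  have hinner : ∀ ξ : ℝ,
      ∫⁻ τ : ℝ, stripWeight b β S₁ (ζ - !₂[ξ, τ]) ^ 2 * stripWeight b β S₂ !₂[ξ, τ] ^ 2 ≤
        ENNReal.ofReal (2 ^ (2 * β)) * (2 * (ENNReal.ofReal (1 / (2 * π)) * J)) *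
          indicator T (fun ξ => decay (2 * β) (f ξ)) ξ := by
    intro ξ
    by_cases hξ : ξ ∈ T
    · rw [indicator_of_mem hξ]
      set c₁ : ℝ := 2 * π * ζ 1 - b * (2 * π * (ζ 0 - ξ)) ^ 3
      set c₂ : ℝ := b * (2 * π * ξ) ^ 3
      have h1 : ∀ τ : ℝ,
          stripWeight b β S₁ (ζ - !₂[ξ, τ]) ^ 2 * stripWeight b β S₂ !₂[ξ, τ] ^ 2 ≤
          ENNReal.ofReal (2 ^ (2 * β)) * decay (2 * β) (f ξ) *
            (decay (2 * β) (2 * π * τ + -c₁) + decay (2 * β) (2 * π * τ + -c₂)) := by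
        intro τ
        have h2 : stripWeight b β S₁ (ζ - !₂[ξ, τ]) ^ 2 = decay (2 * β) (c₁ - 2 * π * τ) := by
          rw [stripWeight_sq]
          have : 2 * π * (ζ - !₂[ξ, τ]) 0 ∈ S₁ := hξ.1
          rw [indicator_of_mem this]
          congr 1
          simp only [PiLp.sub_apply, c₁]
          simp
          ring
        have h3 : stripWeight b β S₂ !₂[ξ, τ] ^ 2 = decay (2 * β) (2 * π * τ + -c₂) := by
          rw [stripWeight_sq]
          have : 2 * π * (!₂[ξ, τ] : Plane) 0 ∈ S₂ := hξ.2
          rw [indicator_of_mem this]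
          rfl
        have h4 : decay (2 * β) (2 * π * τ + -c₁) = decay (2 * β) (c₁ - 2 * π * τ) := by
          rw [decay, decay, bracket, bracket, ← abs_neg]
          congr 4; ring
        rw [h2, h3, h4]
        refine (decay_mul_decay_le (by positivity) _ _).trans_eq ?_
        congr 3
        simp only [hf, c₁, c₂]
        ring
      have hdm : ∀ c : ℝ, Measurable fun τ : ℝ => decay (2 * β) (2 * π * τ + -c) := fun c =>
        (measurable_decay _).comp (by fun_prop)
      refine (lintegral_mono h1).trans ?_
      have hne : ENNReal.ofReal (2 ^ (2 * β)) * decay (2 * β) (f ξ) ≠ ∞ :=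
        ENNReal.mul_ne_top ENNReal.ofReal_ne_top ENNReal.ofReal_ne_top
      rw [lintegral_const_mul' _ _ hne, lintegral_add_left (hdm c₁)]
      calc _ ≤ ENNReal.ofReal (2 ^ (2 * β)) * decay (2 * β) (f ξ) *
            (ENNReal.ofReal (1 / (2 * π)) * J + ENNReal.ofReal (1 / (2 * π)) * J) := by
            gcongr
            · exact lintegral_comp_two_pi_mul_add_le _ _
            · exact lintegral_comp_two_pi_mul_add_le _ _
        _ = _ := by ring
    · have h1 : ∀ τ : ℝ,
          stripWeight b β S₁ (ζ - !₂[ξ, τ]) ^ 2 * stripWeight b β S₂ !₂[ξ, τ] ^ 2 = 0 := by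
        intro τ
        rw [stripWeight_sq, stripWeight_sq]
        by_cases h2 : 2 * π * ξ ∈ S₂
        · have : 2 * π * (ζ - !₂[ξ, τ]) 0 ∉ S₁ := fun h => hξ ⟨h, h2⟩
          rw [indicator_of_notMem this, zero_mul]
        · have : 2 * π * (!₂[ξ, τ] : Plane) 0 ∉ S₂ := h2
          rw [indicator_of_notMem this, mul_zero]
      simp [h1]
  rw [lintegral_plane (by fun_prop)]
  refine (lintegral_mono hinner).trans ?_
  have hfm : Measurable fun ξ => decay (2 * β) (f ξ) :=
    (measurable_decay _).comp (by fun_prop)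
  rw [lintegral_const_mul _ (hfm.indicator hT), lintegral_indicator hT]
  gcongr

theorem lintegral_stripWeight_sq_mul_le (b β : ℝ) {S : Set ℝ} (hS : MeasurableSet S)
    {φ : ℝ → ℝ≥0∞} (hφ : Measurable φ) :
    ∫⁻ ζ : Plane, stripWeight b β S ζ ^ 2 * φ (2 * π * ζ 0) ≤
      ENNReal.ofReal (1 / (2 * π)) * (∫⁻ y, decay (2 * β) y) *
        (ENNReal.ofReal (1 / (2 * π)) * ∫⁻ y in S, φ y) := by
  set J := ∫⁻ y, decay (2 * β) y with hJ
  have hm := measurable_stripWeight b β hS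
  have h0 : Measurable fun ζ : Plane => φ (2 * π * ζ 0) := hφ.comp (by fun_prop)
  rw [lintegral_plane (by fun_prop)]
  have hinner : ∀ ξ : ℝ, ∫⁻ τ : ℝ, stripWeight b β S !₂[ξ, τ] ^ 2 * φ (2 * π * ξ) ≤
      ENNReal.ofReal (1 / (2 * π)) * J * indicator S φ (2 * π * ξ + 0) := by
    intro ξ
    rw [add_zero]
    by_cases hξ : 2 * π * ξ ∈ S
    · have h1 : ∀ τ : ℝ, stripWeight b β S !₂[ξ, τ] ^ 2 =
          decay (2 * β) (2 * π * τ + -(b * (2 * π * ξ) ^ 3)) := by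
        intro τ
        rw [stripWeight_sq]
        have : 2 * π * (!₂[ξ, τ] : Plane) 0 ∈ S := hξ
        rw [indicator_of_mem this]
        rfl
      simp_rw [h1]
      have hdm : Measurable fun τ : ℝ =>
          decay (2 * β) (2 * π * τ + -(b * (2 * π * ξ) ^ 3)) :=
        (measurable_decay _).comp (by fun_prop)
      rw [lintegral_mul_const _ hdm, indicator_of_mem hξ]
      gcongr
      exact lintegral_comp_two_pi_mul_add_le _ _
    · have h1 : ∀ τ : ℝ, stripWeight b β S !₂[ξ, τ] ^ 2 = 0 := by
        intro τ
        rw [stripWeight_sq]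
        have : 2 * π * (!₂[ξ, τ] : Plane) 0 ∉ S := hξ
        rw [indicator_of_notMem this]
      simp [h1]
  refine (lintegral_mono hinner).trans ?_
  have hSm : Measurable fun ξ : ℝ => indicator S φ (2 * π * ξ + 0) :=
    (hφ.indicator hS).comp (by fun_prop)
  rw [lintegral_const_mul _ hSm]
  gcongr
  exact (lintegral_comp_two_pi_mul_add_le _ _).trans (by rw [lintegral_indicator hS])

/-- The regularity `s > 1/4` enters only here, through `∫ ⟨ξ⟩^{-4s} dξ = 2/(4s-1)`. -/
theorem lintegral_stripWeight_sq_mul_decay_le (b β : ℝ) {s : ℝ} (hs : 1 / 4 < s) {S : Set ℝ}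
    (hS : MeasurableSet S) :
    ∫⁻ ζ : Plane, stripWeight b β S ζ ^ 2 * decay s (2 * π * ζ 0) ^ 4 ≤
      ENNReal.ofReal (1 / (2 * π)) * (∫⁻ y, decay (2 * β) y) *
        (ENNReal.ofReal (1 / (2 * π)) * ENNReal.ofReal (2 / (4 * s - 1))) := by
  refine (lintegral_stripWeight_sq_mul_le b β hS ((measurable_decay s).pow_const 4)).trans ?_
  gcongr
  simp_rw [decay_pow]
  refine (setLIntegral_le_lintegral _ _).trans_eq ?_
  push_cast
  exact lintegral_decay (by linarith)

theorem lintegral_stripWeight_sq_lt_top (b : ℝ) {β : ℝ} (hβ : 1 / 2 < β) {S : Set ℝ}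
    (hS : MeasurableSet S) (hSfin : volume S < ∞) :
    ∫⁻ ζ : Plane, stripWeight b β S ζ ^ 2 < ∞ := by
  have h := lintegral_stripWeight_sq_mul_le b β hS (measurable_const (a := (1 : ℝ≥0∞)))
  simp only [mul_one, setLIntegral_const, one_mul] at h
  refine h.trans_lt ?_
  rw [lintegral_decay (by linarith)]
  exact ENNReal.mul_lt_top (ENNReal.mul_lt_top ENNReal.ofReal_lt_top ENNReal.ofReal_lt_top)
    (ENNReal.mul_lt_top ENNReal.ofReal_lt_top hSfin)

/-! ### Frequency localization is local in time -/

/-- The Fourier transform of `U`, cut off sharply to the strip `2πξ ∈ S`. -/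
noncomputable def stripPart (S : Set ℝ) (U : L2Plane) : Plane → ℂ :=
  indicator {ζ : Plane | 2 * π * ζ 0 ∈ S} (𝓕 U : L2Plane)

theorem measurableSet_strip {S : Set ℝ} (hS : MeasurableSet S) :
    MeasurableSet {ζ : Plane | 2 * π * ζ 0 ∈ S} :=
  (by fun_prop : Measurable fun ζ : Plane => 2 * π * ζ 0) hS

theorem integral_plane {f : Plane → ℂ} (hf : Integrable f) :
    ∫ p, f p = ∫ x : ℝ, ∫ t : ℝ, f !₂[x, t] := by
  rw [← measurePreserving_planeEquiv_symm.integral_comp planeEquiv.symm.measurableEmbedding,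
    Measure.volume_eq_prod]
  exact integral_prod _ (integrable_plane_iff.2 hf)

/-- A Fourier multiplier that only depends on `ξ` does not enlarge the support in time. -/
theorem fourier_indicator_strip_fourierInv_eq_zero {S : Set ℝ} (hS : MeasurableSet S)
    {T : Set ℝ} (hT : IsClosed T) {φ : Plane → ℂ} (hφ : Integrable φ) (hφ' : Integrable (𝓕⁻ φ))
    (hφT : ∀ p, p 1 ∉ T → φ p = 0) {p : Plane} (hp : p 1 ∉ T) :
    𝓕 (indicator {ζ : Plane | 2 * π * ζ 0 ∈ S} (𝓕⁻ φ)) p = 0 := by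
  set ψ : Plane → ℂ := indicator {ζ : Plane | 2 * π * ζ 0 ∈ S} (𝓕⁻ φ) with hψdef
  have hψ : Integrable ψ := hφ'.indicator (measurableSet_strip hS)
  have hint : Integrable fun ζ : Plane => 𝐞 (-inner ℝ ζ p) • ψ ζ :=
    (Real.fourierIntegral_convergent_iff p).2 hψ
  rw [Real.fourier_eq, integral_plane hint]
  refine integral_eq_zero_of_ae ?_
  filter_upwards [(integrable_plane_iff.2 hφ').prod_right_ae] with ξ hξ
  simp only [Pi.zero_apply]
  by_cases hmem : 2 * π * ξ ∈ S
  swap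
  · refine integral_eq_zero_of_ae (Filter.Eventually.of_forall fun τ => ?_)
    have : (!₂[ξ, τ] : Plane) ∉ {ζ : Plane | 2 * π * ζ 0 ∈ S} := hmem
    simp only [hψdef, indicator_of_notMem this, smul_zero, Pi.zero_apply]
  -- For fixed `ξ`, the partial Fourier transform `q` of `φ` in `x` vanishes near `t = p 1`, and
  -- one-dimensional Fourier inversion applies to it there.
  set q : ℝ → ℂ := fun t => ∫ x : ℝ, 𝐞 (x * ξ) • φ !₂[x, t]
  have hq : Integrable q := by
    have h1 : Integrable fun v : Plane => 𝐞 (v 0 * ξ) • φ v := by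
      have := (Real.fourierIntegral_convergent_iff (f := φ) (-!₂[ξ, 0] : Plane)).2 hφ
      simpa [PiLp.inner_apply, Fin.sum_univ_two, mul_comm] using this
    exact (integrable_plane_iff.2 h1).integral_prod_right
  have hqinv : ∀ τ, 𝓕⁻ φ !₂[ξ, τ] = 𝓕⁻ q τ := fun τ => fourierInv_mk hφ ξ τ
  have hq' : Integrable (𝓕⁻ q) := hξ.congr (Filter.Eventually.of_forall fun τ => hqinv τ)
  have hqF : Integrable (𝓕 q) := by
    refine hq'.comp_neg.congr (Filter.Eventually.of_forall fun τ => ?_)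
    simp only [fourierInv_eq_fourier_neg, neg_neg]
  have hqT : ∀ t ∈ Tᶜ, q t = 0 := by
    intro t ht
    refine integral_eq_zero_of_ae (Filter.Eventually.of_forall fun x => ?_)
    have : φ !₂[x, t] = 0 := hφT _ ht
    simp only [this, smul_zero, Pi.zero_apply]
  have hcont : ContinuousAt q (p 1) := by
    refine ContinuousAt.congr (continuousAt_const (y := (0 : ℂ))) ?_
    filter_upwards [hT.isOpen_compl.mem_nhds hp] with t ht
    exact (hqT t ht).symm
  have hinv := hq.fourier_fourierInv_eq hqF hcont
  rw [hqT _ hp, Real.fourier_eq] at hinv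
  calc ∫ τ : ℝ, 𝐞 (-inner ℝ !₂[ξ, τ] p) • ψ !₂[ξ, τ]
      = ∫ τ : ℝ, ((𝐞 (-(ξ * p 0)) : Circle) : ℂ) • (𝐞 (-inner ℝ τ (p 1)) • 𝓕⁻ q τ) := by
        congr 1; ext τ
        have : (!₂[ξ, τ] : Plane) ∈ {ζ : Plane | 2 * π * ζ 0 ∈ S} := hmem
        rw [← Circle.smul_def, smul_smul, ← AddChar.map_add_eq_mul, ← hqinv, hψdef,
          indicator_of_mem this]
        congr 2
        simp [PiLp.inner_apply, Fin.sum_univ_two]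
        ring
    _ = 0 := by rw [integral_smul, hinv, smul_zero]

/-- An `L²` extension `U` of the restriction of a Schwartz function `v` to a time interval may be
replaced by its frequency-localized part, if `v` itself is frequency localized. -/
theorem fourierInv_stripPart_eq {S : Set ℝ} (hS : MeasurableSet S) {ρ : ℝ} {U : L2Plane}
    {v : 𝓢(Plane, ℂ)} (hU : ∀ᵐ p : Plane, p 1 ∈ Icc 0 ρ → U p = v p)
    (hv : ∀ ζ : Plane, 2 * π * ζ 0 ∉ S → 𝓕 (v : Plane → ℂ) ζ = 0)
    (hint : Integrable (stripPart S U)) {p : Plane} (hp : p 1 ∈ Ioo 0 ρ) :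
    𝓕⁻ (stripPart S U) p = v p := by
  set Ω : Set Plane := {p | p 1 ∈ Ioo 0 ρ} with hΩ
  have hΩo : IsOpen Ω := isOpen_Ioo.preimage (by fun_prop : Continuous fun p : Plane => p 1)
  have hcont := continuous_fourierInv hint
  set D : L2Plane := U - v.toLp 2 volume with hD
  have hDzero : ∀ᵐ p : Plane, p 1 ∈ Icc 0 ρ → D p = 0 := by
    filter_upwards [hU, Lp.coeFn_sub U (v.toLp 2 volume), v.coeFn_toLp 2] with p h1 h2 h3 hp
    rw [h2, Pi.sub_apply, h3, h1 hp, sub_self]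
  have hFD : (𝓕 D : L2Plane) =ᵐ[volume] fun ζ => (𝓕 U : L2Plane) ζ - 𝓕 (v : Plane → ℂ) ζ := by
    have h0 : (𝓕 D : L2Plane) = 𝓕 U - (𝓕 v).toLp 2 volume := by
      rw [← SchwartzMap.toLp_fourier_eq]
      exact map_sub (Lp.fourierTransformₗᵢ Plane ℂ) U (v.toLp 2 volume)
    rw [h0]
    filter_upwards [Lp.coeFn_sub (𝓕 U : L2Plane) ((𝓕 v).toLp 2 volume), (𝓕 v).coeFn_toLp 2]
      with ζ h2 h3
    rw [h2, Pi.sub_apply, h3, SchwartzMap.fourier_coe]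
  have hvint : Integrable (𝓕 (v : Plane → ℂ)) := by
    rw [← SchwartzMap.fourier_coe]; exact (𝓕 v).integrable
  have hvinv : 𝓕⁻ (𝓕 (v : Plane → ℂ)) = v :=
    v.continuous.fourierInv_fourier_eq v.integrable hvint
  have hae : ∀ᵐ p : Plane, p ∈ Ω → 𝓕⁻ (stripPart S U) p - v p = 0 := by
    refine hΩo.ae_eq_zero_of_integral_contDiff_smul_eq_zero
      ((hcont.sub v.continuous).locallyIntegrable.locallyIntegrableOn _) ?_
    intro g g_smooth g_cpt g_supp
    have hg₁ : HasCompactSupport (Complex.ofRealCLM ∘ g) := g_cpt.comp_left rfl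
    have hg₂ : ContDiff ℝ ((⊤ : ℕ∞) : WithTop ℕ∞) (Complex.ofRealCLM ∘ g) :=
      Complex.ofRealCLM.contDiff.comp g_smooth
    set φ : 𝓢(Plane, ℂ) := hg₁.toSchwartzMap hg₂
    have hφ : ∀ x, φ x = g x := fun x => rfl
    have hφ0 : ∀ p : Plane, p 1 ∉ Icc 0 ρ → φ p = 0 := by
      intro p hp
      rw [hφ, image_eq_zero_of_notMem_tsupport fun h => hp (Ioo_subset_Icc_self (g_supp h)),
        Complex.ofReal_zero]
    have hφint : Integrable (𝓕⁻ (φ : Plane → ℂ)) := by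
      rw [← SchwartzMap.fourierInv_coe]; exact (𝓕⁻ φ).integrable
    set ψ : Plane → ℂ := indicator {ζ : Plane | 2 * π * ζ 0 ∈ S} (𝓕⁻ (φ : Plane → ℂ)) with hψ
    have hψ1 : Integrable ψ := hφint.indicator (measurableSet_strip hS)
    have hψ2 : MemLp ψ 2 := by
      have := (𝓕⁻ φ).memLp 2
      rw [SchwartzMap.fourierInv_coe] at this
      exact this.indicator (measurableSet_strip hS)
    have hbdd : ∀ ζ, ‖𝓕⁻ (φ : Plane → ℂ) ζ‖ ≤ ∫ v, ‖φ v‖ := fun ζ => norm_fourierInv_le ζ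
    have hφm : AEStronglyMeasurable (𝓕⁻ (φ : Plane → ℂ)) volume := hφint.1
    calc ∫ p, g p • (𝓕⁻ (stripPart S U) p - v p)
        = ∫ p, (𝓕⁻ (stripPart S U) p * φ p - 𝓕⁻ (𝓕 (v : Plane → ℂ)) p * φ p) := by
          congr 1; ext p
          rw [hvinv, hφ, Complex.real_smul]; ring
      _ = (∫ p, 𝓕⁻ (stripPart S U) p * φ p) - ∫ p, 𝓕⁻ (𝓕 (v : Plane → ℂ)) p * φ p := by
          refine integral_sub ?_ ?_
          · exact φ.integrable.bdd_mul (c := ∫ ζ, ‖stripPart S U ζ‖) hcont.aestronglyMeasurable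
              (Filter.Eventually.of_forall fun p => norm_fourierInv_le p)
          · exact φ.integrable.bdd_mul (c := ∫ ζ, ‖𝓕 (v : Plane → ℂ) ζ‖)
              (continuous_fourierInv hvint).aestronglyMeasurable
              (Filter.Eventually.of_forall fun p => norm_fourierInv_le p)
      _ = (∫ ζ, stripPart S U ζ * 𝓕⁻ (φ : Plane → ℂ) ζ) -
            ∫ ζ, 𝓕 (v : Plane → ℂ) ζ * 𝓕⁻ (φ : Plane → ℂ) ζ := by
          rw [integral_fourierInv_mul hint φ.integrable,
            integral_fourierInv_mul hvint φ.integrable]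
      _ = ∫ ζ, (stripPart S U ζ * 𝓕⁻ (φ : Plane → ℂ) ζ -
            𝓕 (v : Plane → ℂ) ζ * 𝓕⁻ (φ : Plane → ℂ) ζ) := by
          refine (integral_sub ?_ ?_).symm
          · exact hint.mul_bdd hφm (Filter.Eventually.of_forall hbdd)
          · exact hvint.mul_bdd hφm (Filter.Eventually.of_forall hbdd)
      _ = ∫ ζ, (𝓕 D : L2Plane) ζ * ψ ζ := by
          refine integral_congr_ae ?_
          filter_upwards [hFD] with ζ hζ
          rw [hζ]
          by_cases hmem : ζ ∈ {ζ : Plane | 2 * π * ζ 0 ∈ S}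
          · rw [stripPart, hψ, indicator_of_mem hmem, indicator_of_mem hmem, sub_mul]
          · rw [stripPart, hψ, indicator_of_notMem hmem, indicator_of_notMem hmem, hv ζ hmem]
            simp
      _ = ∫ p, D p * 𝓕 ψ p := integral_fourier_mul_of_memLp D hψ1 hψ2
      _ = 0 := by
          refine integral_eq_zero_of_ae ?_
          filter_upwards [hDzero] with p hp
          by_cases hmem : p 1 ∈ Icc 0 ρ
          · rw [hp hmem, zero_mul, Pi.zero_apply]
          · rw [fourier_indicator_strip_fourierInv_eq_zero hS isClosed_Icc φ.integrable hφint hφ0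
              hmem, mul_zero, Pi.zero_apply]
  have heq : 𝓕⁻ (stripPart S U) =ᵐ[volume.restrict Ω] v := by
    refine (ae_restrict_iff' hΩo.measurableSet).2 ?_
    filter_upwards [hae] with p h hp
    exact sub_eq_zero.1 (h hp)
  exact Measure.eqOn_open_of_ae_eq heq hΩo hcont.continuousOn v.continuous.continuousOn hp

/-! ### The norms of the Bourgain spaces -/

/-- The modulus of `⟨τ - bξ³⟩^β ⟨ξ⟩^s û` in the variables of the transform with kernel
`e^{-2πi(xξ+tτ)}`. -/
noncomputable def weightedHat (b s β : ℝ) (U : L2Plane) (ζ : Plane) : ℝ≥0∞ :=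
  ENNReal.ofReal (bracket (2 * π * ζ 1 - b * (2 * π * ζ 0) ^ 3) ^ β * bracket (2 * π * ζ 0) ^ s) *
    ‖(𝓕 U : L2Plane) ζ‖ₑ

theorem measurable_weightedHat (b s β : ℝ) (U : L2Plane) : Measurable (weightedHat b s β U) := by
  have h1 : Continuous fun ζ : Plane => bracket (2 * π * ζ 1 - b * (2 * π * ζ 0) ^ 3) ^ β *
      bracket (2 * π * ζ 0) ^ s :=
    ((continuous_bracket.comp (by fun_prop)).rpow_const fun _ => Or.inl (bracket_pos _).ne').mul
      ((continuous_bracket.comp (by fun_prop)).rpow_const fun _ => Or.inl (bracket_pos _).ne')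
  exact h1.measurable.ennreal_ofReal.mul (Lp.stronglyMeasurable _).measurable.enorm

/-- The passage between the two normalizations of the Fourier transform is a dilation by `2π`. -/
theorem xNorm_sq (b s β : ℝ) (U : L2Plane) :
    xNorm b s β U ^ 2 = ENNReal.ofReal ((2 * π) ^ 2) * ∫⁻ ζ, weightedHat b s β U ζ ^ 2 := by
  have h2π : (2 * π)⁻¹ ≠ 0 := inv_ne_zero two_pi_pos.ne'
  have hm := (measurable_weightedHat b s β U).pow_const 2
  have hmap := Measure.map_addHaar_smul (volume : Measure Plane) h2π
  have h1 : ∫⁻ η, weightedHat b s β U ((2 * π)⁻¹ • η) ^ 2 =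
      ENNReal.ofReal ((2 * π) ^ 2) * ∫⁻ ζ, weightedHat b s β U ζ ^ 2 := by
    rw [← lintegral_map hm (measurable_const_smul _), hmap, lintegral_smul_measure, smul_eq_mul]
    congr 2
    rw [finrank_euclideanSpace_fin, inv_pow, inv_inv, abs_of_nonneg (by positivity)]
  rw [xNorm, eLpNorm_two_sq, ← h1]
  refine lintegral_congr fun η => ?_
  have h3 : ∀ i, 2 * π * ((2 * π)⁻¹ • η) i = η i := by
    intro i
    rw [PiLp.smul_apply, smul_eq_mul, mul_inv_cancel_left₀ two_pi_pos.ne']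
  rw [weightedHat, h3, h3, hatL2, enorm_mul]
  congr 2
  rw [← ofReal_norm, Complex.norm_real, Real.norm_of_nonneg (mul_nonneg
    (rpow_nonneg (bracket_pos _).le _) (rpow_nonneg (bracket_pos _).le _))]

theorem lintegral_weightedHat_sq_le (b s β : ℝ) (U : L2Plane) :
    ∫⁻ ζ, weightedHat b s β U ζ ^ 2 ≤ xNorm b s β U ^ 2 := by
  rw [xNorm_sq]
  refine le_mul_of_one_le_left zero_le ?_
  rw [← ENNReal.ofReal_one]
  exact ENNReal.ofReal_le_ofReal (by nlinarith [pi_gt_three])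

theorem enorm_stripPart_le (b s β : ℝ) (S : Set ℝ) (U : L2Plane) (ζ : Plane) :
    ‖stripPart S U ζ‖ₑ ≤
      stripWeight b β S ζ * decay s (2 * π * ζ 0) * weightedHat b s β U ζ := by
  by_cases h : 2 * π * ζ 0 ∈ S
  · have h' : ζ ∈ {ζ : Plane | 2 * π * ζ 0 ∈ S} := h
    have hr : ∀ y r : ℝ, bracket y ^ (-r) * bracket y ^ r = 1 := fun y r => by
      rw [← rpow_add (bracket_pos y), neg_add_cancel, rpow_zero]
    have hn : ∀ y r : ℝ, 0 ≤ bracket y ^ r := fun y r => rpow_nonneg (bracket_pos y).le r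
    rw [stripPart, indicator_of_mem h', stripWeight, indicator_of_mem h, weightedHat, decay, decay,
      ← mul_assoc, ← ENNReal.ofReal_mul (hn _ _),
      ← ENNReal.ofReal_mul (mul_nonneg (hn _ _) (hn _ _)),
      mul_mul_mul_comm, hr, hr, mul_one, ENNReal.ofReal_one, one_mul]
  · have h' : ζ ∉ {ζ : Plane | 2 * π * ζ 0 ∈ S} := h
    rw [stripPart, indicator_of_notMem h', enorm_zero]
    exact zero_le

theorem decay_le_one {p : ℝ} (hp : 0 ≤ p) (y : ℝ) : decay p y ≤ 1 := by
  rw [decay, ← ENNReal.ofReal_one]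
  exact ENNReal.ofReal_le_ofReal (rpow_le_one_of_one_le_of_nonpos (one_le_bracket y) (by linarith))

theorem integrable_stripPart {b s β : ℝ} (hs : 0 ≤ s) (hβ : 1 / 2 < β) {S : Set ℝ}
    (hS : MeasurableSet S) (hSfin : volume S < ∞) {U : L2Plane} (hU : xNorm b s β U < ∞) :
    Integrable (stripPart S U) := by
  refine ⟨(Lp.aestronglyMeasurable _).indicator (measurableSet_strip hS), ?_⟩
  have hm₁ := measurable_stripWeight b β hS
  have hm₂ := measurable_weightedHat b s β U
  have h1 : ∫⁻ ζ, ‖stripPart S U ζ‖ₑ ≤ ∫⁻ ζ, stripWeight b β S ζ * weightedHat b s β U ζ := by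
    refine lintegral_mono fun ζ => (enorm_stripPart_le b s β S U ζ).trans ?_
    gcongr
    exact mul_le_of_le_one_right zero_le (decay_le_one hs _)
  have h2 := sq_lintegral_mul_le (μ := volume) hm₁.aemeasurable hm₂.aemeasurable
  have h3 : (∫⁻ ζ, stripWeight b β S ζ * weightedHat b s β U ζ) ^ 2 < ∞ :=
    h2.trans_lt (ENNReal.mul_lt_top (lintegral_stripWeight_sq_lt_top b hβ hS hSfin)
      ((lintegral_weightedHat_sq_le b s β U).trans_lt (ENNReal.pow_lt_top hU)))
  exact h1.trans_lt ((ENNReal.pow_lt_top_iff.1 h3).resolve_right two_ne_zero)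

/-- Schwartz functions belong to all spaces `X_{s,β}`. -/
theorem xNorm_toLp_lt_top (b : ℝ) {s β : ℝ} (hs : 0 ≤ s) (hβ : 0 ≤ β) (v : 𝓢(Plane, ℂ)) :
    xNorm b s β (v.toLp 2) < ∞ := by
  obtain ⟨k, hk⟩ := exists_nat_ge (3 * β + s)
  set c₁ : ℝ := 1 + 2 * π + |b| * (2 * π) ^ 3
  set c₂ : ℝ := 1 + 2 * π
  have hc₁ : 0 < c₁ := by positivity
  have hc₂ : 0 < c₂ := by positivity
  have hweight : ∀ ζ : Plane, bracket (2 * π * ζ 1 - b * (2 * π * ζ 0) ^ 3) ^ β *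
      bracket (2 * π * ζ 0) ^ s ≤ c₁ ^ β * c₂ ^ s * (1 + ‖ζ‖) ^ k := by
    intro ζ
    have e0 : |ζ 0| ≤ ‖ζ‖ := PiLp.norm_apply_le ζ 0
    have e1 : |ζ 1| ≤ ‖ζ‖ := PiLp.norm_apply_le ζ 1
    have hn := norm_nonneg ζ
    have h1 : bracket (2 * π * ζ 1 - b * (2 * π * ζ 0) ^ 3) ≤ c₁ * (1 + ‖ζ‖) ^ 3 := by
      have h3 : |2 * π * ζ 1 - b * (2 * π * ζ 0) ^ 3| ≤
          2 * π * ‖ζ‖ + |b| * (2 * π) ^ 3 * ‖ζ‖ ^ 3 := by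
        refine (abs_sub _ _).trans ?_
        rw [abs_mul, abs_mul b, abs_pow, abs_mul (2 * π), abs_of_pos two_pi_pos, mul_pow,
          ← mul_assoc]
        gcongr
      have h4 : ‖ζ‖ ^ 3 ≤ (1 + ‖ζ‖) ^ 3 := by gcongr; linarith
      have h5 : 1 + ‖ζ‖ ≤ (1 + ‖ζ‖) ^ 3 := le_self_pow₀ (by linarith) (by norm_num)
      have h6 : (1 : ℝ) ≤ (1 + ‖ζ‖) ^ 3 := one_le_pow₀ (by linarith)
      have h7 : 2 * π * ‖ζ‖ ≤ 2 * π * (1 + ‖ζ‖) ^ 3 := by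
        gcongr; linarith
      have h8 : |b| * (2 * π) ^ 3 * ‖ζ‖ ^ 3 ≤ |b| * (2 * π) ^ 3 * (1 + ‖ζ‖) ^ 3 := by gcongr
      unfold bracket
      simp only [c₁]
      linarith
    have h2 : bracket (2 * π * ζ 0) ≤ c₂ * (1 + ‖ζ‖) := by
      unfold bracket
      simp only [c₂]
      rw [abs_mul, abs_of_pos two_pi_pos]
      have : 2 * π * |ζ 0| ≤ 2 * π * ‖ζ‖ := by gcongr
      nlinarith [two_pi_pos]
    calc _ ≤ (c₁ * (1 + ‖ζ‖) ^ 3) ^ β * (c₂ * (1 + ‖ζ‖)) ^ s := by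
          gcongr
          · exact rpow_nonneg (bracket_pos _).le _
          · exact (bracket_pos _).le
          · exact (bracket_pos _).le
      _ = c₁ ^ β * c₂ ^ s * (1 + ‖ζ‖) ^ (3 * β + s) := by
          rw [mul_rpow hc₁.le (by positivity), mul_rpow hc₂.le (by positivity),
            rpow_add (by positivity), rpow_mul (by positivity)]
          norm_cast
          ring
      _ ≤ c₁ ^ β * c₂ ^ s * (1 + ‖ζ‖) ^ (k : ℝ) := by
          gcongr
          linarith
      _ = _ := by rw [rpow_natCast]
  obtain ⟨C, hC⟩ : ∃ C : ℝ, ∀ ζ : Plane, (1 + ‖ζ‖) ^ (k + 2) * ‖𝓕 v ζ‖ ≤ C := by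
    refine ⟨2 ^ (k + 2) * (Finset.Iic (k + 2, 0)).sup
      (fun m => SchwartzMap.seminorm ℝ m.1 m.2) (𝓕 v), fun ζ => ?_⟩
    have := SchwartzMap.one_add_le_sup_seminorm_apply (𝕜 := ℝ) (m := (k + 2, 0)) (k := k + 2)
      (n := 0) le_rfl le_rfl (𝓕 v) ζ
    rwa [norm_iteratedFDeriv_zero] at this
  have hpt : ∀ᵐ ζ : Plane, weightedHat b s β (v.toLp 2) ζ ^ 2 ≤
      ENNReal.ofReal ((c₁ ^ β * c₂ ^ s * C) ^ 2) * ENNReal.ofReal ((1 + ‖ζ‖) ^ (-(4 : ℝ))) := by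
    rw [Filter.eventually_iff_exists_mem]
    refine ⟨_, (𝓕 v).coeFn_toLp 2 volume, fun ζ hζ => ?_⟩
    have hζ' : (𝓕 (v.toLp 2 volume) : L2Plane) ζ = 𝓕 v ζ := by
      rw [SchwartzMap.toLp_fourier_eq]; exact hζ
    have hp : 0 < 1 + ‖ζ‖ := by positivity
    rw [weightedHat, hζ', ← ofReal_norm, ← ENNReal.ofReal_mul (mul_nonneg
      (rpow_nonneg (bracket_pos _).le _) (rpow_nonneg (bracket_pos _).le _)),
      ← ENNReal.ofReal_pow (mul_nonneg (mul_nonneg (rpow_nonneg (bracket_pos _).le _)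
      (rpow_nonneg (bracket_pos _).le _)) (norm_nonneg _)), ← ENNReal.ofReal_mul (by positivity)]
    refine ENNReal.ofReal_le_ofReal ?_
    have h4 : (1 + ‖ζ‖) ^ (-(4 : ℝ)) = (((1 + ‖ζ‖) ^ 2)⁻¹) ^ 2 := by
      rw [rpow_neg hp.le, inv_pow, ← pow_mul]
      norm_cast
    rw [h4, ← mul_pow]
    refine pow_le_pow_left₀ (mul_nonneg (mul_nonneg (rpow_nonneg (bracket_pos _).le _)
      (rpow_nonneg (bracket_pos _).le _)) (norm_nonneg _)) ?_ 2
    rw [← div_eq_mul_inv, le_div_iff₀ (by positivity)]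
    calc _ ≤ c₁ ^ β * c₂ ^ s * (1 + ‖ζ‖) ^ k * ‖𝓕 v ζ‖ * (1 + ‖ζ‖) ^ 2 := by
          exact mul_le_mul_of_nonneg_right
            (mul_le_mul_of_nonneg_right (hweight ζ) (norm_nonneg _)) (by positivity)
      _ = c₁ ^ β * c₂ ^ s * ((1 + ‖ζ‖) ^ (k + 2) * ‖𝓕 v ζ‖) := by ring
      _ ≤ _ := by gcongr; exact hC ζ
  have hfin : ∫⁻ ζ : Plane, ENNReal.ofReal ((1 + ‖ζ‖) ^ (-(4 : ℝ))) < ∞ :=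
    finite_integral_one_add_norm (by rw [finrank_euclideanSpace_fin]; norm_num)
  have h2 : xNorm b s β (v.toLp 2) ^ 2 < ∞ := by
    rw [xNorm_sq]
    refine ENNReal.mul_lt_top ENNReal.ofReal_lt_top ((lintegral_mono_ae hpt).trans_lt ?_)
    rw [lintegral_const_mul' _ _ ENNReal.ofReal_ne_top]
    exact ENNReal.mul_lt_top ENNReal.ofReal_lt_top hfin
  exact (ENNReal.pow_lt_top_iff.1 h2).resolve_right two_ne_zero

theorem hat_eq_fourier (v : 𝓢(Plane, ℂ)) (ζ : Plane) :
    hat v ((2 * π) • ζ) = 𝓕 (v : Plane → ℂ) ζ := by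
  rw [hat, Real.fourier_eq']
  congr 1; ext p
  rw [smul_eq_mul]
  congr 2
  simp [PiLp.inner_apply, Fin.sum_univ_two]
  ring

theorem fourier_eq_zero_of_support_hat {v : 𝓢(Plane, ℂ)} {S : Set ℝ}
    (hv : Function.support (hat v) ⊆ {ζ | ζ 0 ∈ S}) (ζ : Plane) (hζ : 2 * π * ζ 0 ∉ S) :
    𝓕 (v : Plane → ℂ) ζ = 0 := by
  by_contra h
  rw [← hat_eq_fourier] at h
  exact hζ (hv h)

theorem fourierInv_stripPart_toLp {v : 𝓢(Plane, ℂ)} {S : Set ℝ}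
    (hv : ∀ ζ : Plane, 2 * π * ζ 0 ∉ S → 𝓕 (v : Plane → ℂ) ζ = 0) :
    𝓕⁻ (stripPart S (v.toLp 2)) = v := by
  have hvint : Integrable (𝓕 (v : Plane → ℂ)) := by
    rw [← SchwartzMap.fourier_coe]; exact (𝓕 v).integrable
  rw [← v.continuous.fourierInv_fourier_eq v.integrable hvint]
  ext p
  refine Real.fourierInv_congr_ae ?_ p
  have h := (𝓕 v).coeFn_toLp 2 volume
  filter_upwards [h] with ζ hζ
  have hζ' : (𝓕 (v.toLp 2 volume) : L2Plane) ζ = 𝓕 (v : Plane → ℂ) ζ := by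
    rw [SchwartzMap.toLp_fourier_eq, hζ, SchwartzMap.fourier_coe]
  by_cases hmem : ζ ∈ {ζ : Plane | 2 * π * ζ 0 ∈ S}
  · rw [stripPart, indicator_of_mem hmem, hζ']
  · rw [stripPart, indicator_of_notMem hmem, hv ζ hmem]

/-! ### The improved bilinear Strichartz estimate -/

/-- The fourth power of the constant in the bilinear estimate: twice the product of the bounds of
the three weight integrals, without their factors `N⁻²`, `N⁻²` and `1/(4s-1)`. -/
noncomputable def bilinearConst (b β κ c₁ : ℝ) : ℝ :=
  2 * ((1 / (6 * π * |b| * c₁ ^ 2)) * (2 / (2 * β - 1))) *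
    (2 ^ (2 * β) * (2 * ((1 / (2 * π)) * (2 / (2 * β - 1)))) *
      ((1 / (6 * π * |b| * (c₁ ^ 2 - κ ^ 2))) * (2 / (2 * β - 1)))) *
    ((1 / (2 * π)) * (2 / (2 * β - 1)) * ((1 / (2 * π)) * 2))

theorem bilinearConst_pos {b β κ c₁ : ℝ} (hb : b ≠ 0) (hβ : 1 / 2 < β) (hκ : 0 < κ)
    (hκc : κ < c₁) : 0 < bilinearConst b β κ c₁ := by
  have h1 : 0 < 2 * β - 1 := by linarith
  have h2 : 0 < c₁ ^ 2 - κ ^ 2 := by nlinarith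
  have h3 : 0 < c₁ := hκ.trans hκc
  have h4 : 0 < |b| := abs_pos.2 hb
  unfold bilinearConst
  positivity

/-- The strip of high frequencies. -/
def highStrip (c₁ c₂ N : ℝ) : Set ℝ := {y | c₁ * N ≤ |y| ∧ |y| ≤ c₂ * N}

/-- The strip of low frequencies. -/
def lowStrip (κ N : ℝ) : Set ℝ := {y | |y| ≤ κ * N}

theorem measurableSet_highStrip (c₁ c₂ N : ℝ) : MeasurableSet (highStrip c₁ c₂ N) :=
  (measurableSet_le measurable_const measurable_id.abs).inter
    (measurableSet_le measurable_id.abs measurable_const)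

theorem measurableSet_lowStrip (κ N : ℝ) : MeasurableSet (lowStrip κ N) :=
  measurableSet_le measurable_id.abs measurable_const

theorem volume_lowStrip_lt_top (κ N : ℝ) : volume (lowStrip κ N) < ∞ := by
  refine (measure_mono (t := Icc (-(κ * N)) (κ * N)) fun y hy => abs_le.1 hy).trans_lt ?_
  exact measure_Icc_lt_top

theorem volume_highStrip_lt_top (c₁ c₂ N : ℝ) : volume (highStrip c₁ c₂ N) < ∞ :=
  (measure_mono fun _ hy => hy.2).trans_lt (volume_lowStrip_lt_top c₂ N)

/-- The bilinear estimate for the frequency-localized parts of two functions in `X_{0,β}` and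
`X_{s,β}`. -/
theorem mixedNorm_stripPart_mul_le {b β κ c₁ c₂ s N : ℝ} (hb : b ≠ 0) (hβ : 1 / 2 < β)
    (hκ : 0 < κ) (hκc : κ < c₁) (hs : 1 / 4 < s) (hN : 0 < N) {U₁ U₂ : L2Plane}
    (hU₁ : xNorm b 0 β U₁ < ∞) (hU₂ : xNorm b s β U₂ < ∞) :
    mixedNorm univ (fun p => 𝓕⁻ (stripPart (highStrip c₁ c₂ N) U₁) p *
        𝓕⁻ (stripPart (lowStrip κ N) U₂) p) ≤
      ENNReal.ofReal (bilinearConst b β κ c₁ ^ (1 / 4 : ℝ) * (1 / (4 * s - 1) ^ (1 / 4 : ℝ)) *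
        (1 / N)) * xNorm b s β U₂ * xNorm b 0 β U₁ := by
  have hS₁ := measurableSet_highStrip c₁ c₂ N
  have hS₂ := measurableSet_lowStrip κ N
  have hc₁ : 0 < c₁ := hκ.trans hκc
  have hc : 0 < c₁ ^ 2 - κ ^ 2 := by nlinarith
  have hβ' : 0 < 2 * β - 1 := by linarith
  have hs' : 0 < 4 * s - 1 := by linarith
  have hb' : 0 < |b| := abs_pos.2 hb
  have hK := bilinearConst_pos hb hβ hκ hκc
  have hsep : ∀ y ∈ highStrip c₁ c₂ N, ∀ z ∈ lowStrip κ N,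
      (c₁ ^ 2 - κ ^ 2) * N ^ 2 ≤ y ^ 2 - z ^ 2 := by
    intro y hy z hz
    have h1 : (c₁ * N) ^ 2 ≤ |y| ^ 2 := pow_le_pow_left₀ (by positivity) hy.1 2
    have h2 : |z| ^ 2 ≤ (κ * N) ^ 2 := pow_le_pow_left₀ (abs_nonneg z) hz 2
    rw [sq_abs] at h1 h2
    linarith
  have h := mixedNorm_fourierInv_mul_pow_four_le
    (ν := fun ζ => decay s (2 * π * ζ 0))
    (integrable_stripPart le_rfl hβ hS₁ (volume_highStrip_lt_top _ _ _) hU₁)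
    (integrable_stripPart (by linarith) hβ hS₂ (volume_lowStrip_lt_top _ _) hU₂)
    (measurable_stripWeight b β hS₁) (measurable_stripWeight b β hS₂)
    ((measurable_decay s).comp (by fun_prop))
    (measurable_weightedHat b 0 β U₁) (measurable_weightedHat b s β U₂)
    (fun ζ => by simpa [decay] using enorm_stripPart_le b 0 β (highStrip c₁ c₂ N) U₁ ζ)
    (enorm_stripPart_le b s β (lowStrip κ N) U₂)
    (lintegral_stripWeight_sq_horizontal_le hb (by positivity : 0 < c₁ * N) hS₁
      fun y hy => hy.1)
    (lintegral_stripWeight_convolution_le hb (by linarith) (by positivity) hS₁ hS₂ hsep)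
    (lintegral_stripWeight_sq_mul_decay_le b β hs hS₂)
  have hconst : (bilinearConst b β κ c₁ ^ (1 / 4 : ℝ) * (1 / (4 * s - 1) ^ (1 / 4 : ℝ)) *
      (1 / N)) ^ 4 = bilinearConst b β κ c₁ / (4 * s - 1) / N ^ 4 := by
    have hroot : ∀ y : ℝ, 0 ≤ y → (y ^ (1 / 4 : ℝ)) ^ 4 = y := fun y hy => by
      rw [← rpow_natCast, ← rpow_mul hy]; norm_num
    rw [mul_pow, mul_pow, div_pow, div_pow, hroot _ hK.le, hroot _ hs'.le]
    field_simp
  have hJ : ∫⁻ y, decay (2 * β) y = ENNReal.ofReal (2 / (2 * β - 1)) :=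
    lintegral_decay (by linarith)
  have h4 : (4 : ℕ) ≠ 0 := by norm_num
  refine (ENNReal.pow_le_pow_left_iff h4).1 (h.trans ?_)
  have e₁ := pow_le_pow_left' (lintegral_weightedHat_sq_le b 0 β U₁) 2
  have e₂ := pow_le_pow_left' (lintegral_weightedHat_sq_le b s β U₂) 2
  refine (mul_le_mul' (mul_le_mul' le_rfl e₁) e₂).trans_eq ?_
  have hR : ∀ (c : ℝ) (X Y : ℝ≥0∞), 0 ≤ c →
      (ENNReal.ofReal c * X * Y) ^ 4 = ENNReal.ofReal (c ^ 4) * X ^ 4 * Y ^ 4 :=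
    fun c X Y hc => by rw [mul_pow, mul_pow, ENNReal.ofReal_pow hc]
  rw [hR _ _ _ (by positivity), hconst, hJ, ← pow_mul, ← pow_mul, mul_right_comm]
  congr 2
  rw [show (2 : ℝ≥0∞) = ENNReal.ofReal 2 by simp]
  simp (discharger := positivity) only [← ENNReal.ofReal_mul]
  congr 1
  rw [bilinearConst]
  field_simp

theorem mixedNorm_mono_set {T : Set ℝ} (f : Plane → ℂ) : mixedNorm T f ≤ mixedNorm univ f :=
  eLpNorm_mono_enorm fun x => by
    simp only [enorm_eq_self]
    exact eLpNorm_mono_measure _ (Measure.restrict_mono_set _ (subset_univ T))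

theorem mixedNorm_congr_Icc {ρ : ℝ} {f g : Plane → ℂ}
    (hfg : ∀ p : Plane, p 1 ∈ Ioo 0 ρ → f p = g p) :
    mixedNorm (Icc 0 ρ) f = mixedNorm (Icc 0 ρ) g := by
  unfold mixedNorm
  congr 1; ext x
  rw [← restrict_Ioo_eq_restrict_Icc]
  refine eLpNorm_congr_ae ?_
  filter_upwards [ae_restrict_mem measurableSet_Ioo] with t ht
  exact hfg _ ht

/-- A bound by a product of two restriction norms follows from the bound for all pairs of
extensions of finite norm. -/
theorem le_mul_xNormOn_mul_xNormOn {ρ b s₁ s₂ β : ℝ} {u₁ u₂ : Plane → ℂ} {M c : ℝ≥0∞}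
    (hc : c ≠ ∞) (hu₁ : xNormOn ρ b s₁ β u₁ < ∞) (hu₂ : xNormOn ρ b s₂ β u₂ < ∞)
    (h : ∀ U₁ U₂ : L2Plane, (∀ᵐ p : Plane, p 1 ∈ Icc 0 ρ → U₁ p = u₁ p) →
      (∀ᵐ p : Plane, p 1 ∈ Icc 0 ρ → U₂ p = u₂ p) → xNorm b s₁ β U₁ < ∞ → xNorm b s₂ β U₂ < ∞ →
      M ≤ c * xNorm b s₂ β U₂ * xNorm b s₁ β U₁) :
    M ≤ c * xNormOn ρ b s₂ β u₂ * xNormOn ρ b s₁ β u₁ := by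
  have key : ∀ ε : ℝ≥0∞, 0 < ε → ε < ∞ →
      M ≤ c * (xNormOn ρ b s₂ β u₂ + ε) * (xNormOn ρ b s₁ β u₁ + ε) := by
    intro ε hε hε'
    have h1 := ENNReal.lt_add_right hu₁.ne hε.ne'
    have h2 := ENNReal.lt_add_right hu₂.ne hε.ne'
    obtain ⟨U₁, h1⟩ := iInf_lt_iff.1 h1
    obtain ⟨hU₁, h1⟩ := iInf_lt_iff.1 h1
    obtain ⟨U₂, h2⟩ := iInf_lt_iff.1 h2
    obtain ⟨hU₂, h2⟩ := iInf_lt_iff.1 h2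
    refine (h U₁ U₂ hU₁ hU₂ (h1.trans (ENNReal.add_lt_top.2 ⟨hu₁, hε'⟩))
      (h2.trans (ENNReal.add_lt_top.2 ⟨hu₂, hε'⟩))).trans ?_
    gcongr
  have hlim : Filter.Tendsto
      (fun ε : ℝ≥0∞ => c * (xNormOn ρ b s₂ β u₂ + ε) * (xNormOn ρ b s₁ β u₁ + ε))
      (nhdsWithin 0 (Ioi 0)) (nhds (c * xNormOn ρ b s₂ β u₂ * xNormOn ρ b s₁ β u₁)) := by
    have hadd : ∀ y : ℝ≥0∞, Filter.Tendsto (fun ε => y + ε) (nhdsWithin 0 (Ioi 0)) (nhds y) := by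
      intro y
      have : Filter.Tendsto (fun ε : ℝ≥0∞ => y + ε) (nhds 0) (nhds (y + 0)) :=
        tendsto_const_nhds.add Filter.tendsto_id
      rw [add_zero] at this
      exact this.mono_left nhdsWithin_le_nhds
    exact ENNReal.Tendsto.mul (ENNReal.Tendsto.const_mul (hadd _) (Or.inr hc))
      (Or.inr hu₁.ne) (hadd _) (Or.inr (ENNReal.mul_ne_top hc hu₂.ne))
  refine ge_of_tendsto hlim ?_
  filter_upwards [self_mem_nhdsWithin, nhdsWithin_le_nhds (Iio_mem_nhds ENNReal.zero_lt_top)]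
    with ε h1 h2
  exact key ε h1 h2

theorem xNormOn_lt_top (ρ b : ℝ) {s β : ℝ} (hs : 0 ≤ s) (hβ : 0 ≤ β) (v : 𝓢(Plane, ℂ)) :
    xNormOn ρ b s β v < ∞ := by
  refine lt_of_le_of_lt (iInf₂_le (v.toLp 2 volume) ?_) (xNorm_toLp_lt_top b hs hβ v)
  filter_upwards [v.coeFn_toLp 2 volume] with p hp _
  exact hp

end Airy

theorem lemma3p2 (b : ℝ) (hb : b ≠ 0) (β : ℝ) (hβ : 1 / 2 < β)
    (κ c₁ c₂ : ℝ) (hκ : 0 < κ) (hκc : κ < c₁) (hc : c₁ ≤ c₂) :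
    ∃ C : ℝ, 0 < C ∧ ∀ s : ℝ, 1 / 4 < s → ∀ N : ℝ, 0 < N →
      ∀ v₁ v₂ : 𝓢(Airy.Plane, ℂ),
        Function.support (Airy.hat v₁) ⊆ {ζ | c₁ * N ≤ |ζ 0| ∧ |ζ 0| ≤ c₂ * N} →
        Function.support (Airy.hat v₂) ⊆ {ζ | |ζ 0| ≤ κ * N} →
        (∀ ρ : ℝ, 0 < ρ →
          Airy.mixedNorm (Icc 0 ρ) (fun p => v₁ p * v₂ p) ≤
            ENNReal.ofReal (C * (1 / (4 * s - 1) ^ (1 / 4 : ℝ)) * (1 / N)) *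
              Airy.xNormOn ρ b s β v₂ * Airy.xNormOn ρ b 0 β v₁) ∧
        Airy.mixedNorm univ (fun p => v₁ p * v₂ p) ≤
          ENNReal.ofReal (C * (1 / (4 * s - 1) ^ (1 / 4 : ℝ)) * (1 / N)) *
            Airy.xNorm b s β (v₂.toLp 2) * Airy.xNorm b 0 β (v₁.toLp 2) := by
  refine ⟨Airy.bilinearConst b β κ c₁ ^ (1 / 4 : ℝ),
    rpow_pos_of_pos (Airy.bilinearConst_pos hb hβ hκ hκc) _, fun s hs N hN v₁ v₂ hv₁ hv₂ => ?_⟩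
  have hβ0 : 0 ≤ β := by linarith
  have hs0 : 0 ≤ s := by linarith
  have hF₁ := Airy.fourier_eq_zero_of_support_hat (S := Airy.highStrip c₁ c₂ N) hv₁
  have hF₂ := Airy.fourier_eq_zero_of_support_hat (S := Airy.lowStrip κ N) hv₂
  have hS₁ := Airy.measurableSet_highStrip c₁ c₂ N
  have hS₂ := Airy.measurableSet_lowStrip κ N
  refine ⟨fun ρ _ => ?_, ?_⟩
  · refine Airy.le_mul_xNormOn_mul_xNormOn ENNReal.ofReal_ne_top
      (Airy.xNormOn_lt_top ρ b le_rfl hβ0 v₁) (Airy.xNormOn_lt_top ρ b hs0 hβ0 v₂) ?_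
    intro U₁ U₂ hU₁ hU₂ hX₁ hX₂
    refine le_trans (le_of_eq ?_) ((Airy.mixedNorm_mono_set (T := Icc 0 ρ) _).trans
      (Airy.mixedNorm_stripPart_mul_le (c₂ := c₂) hb hβ hκ hκc hs hN hX₁ hX₂))
    refine Airy.mixedNorm_congr_Icc fun p hp => ?_
    rw [Airy.fourierInv_stripPart_eq hS₁ hU₁ hF₁ (Airy.integrable_stripPart le_rfl hβ hS₁
        (Airy.volume_highStrip_lt_top _ _ _) hX₁) hp,
      Airy.fourierInv_stripPart_eq hS₂ hU₂ hF₂ (Airy.integrable_stripPart hs0 hβ hS₂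
        (Airy.volume_lowStrip_lt_top _ _) hX₂) hp]
  · have h := Airy.mixedNorm_stripPart_mul_le (c₂ := c₂) hb hβ hκ hκc hs hN
      (Airy.xNorm_toLp_lt_top b le_rfl hβ0 v₁) (Airy.xNorm_toLp_lt_top b hs0 hβ0 v₂)
    rwa [Airy.fourierInv_stripPart_toLp hF₁, Airy.fourierInv_stripPart_toLp hF₂] at h
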